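/- **Setting.** Let $G=(S,A_1,\Sigma,\Gamma_1,\Gamma_2,\mathbf P,O,\mathsf{Obs},s_0,o_0,F)$ be a two-player stochastic reachability game with active sensing and sensor attacks: $S$, $A_1\neq\emptyset$, $\Sigma$ are finite sets of states, control actions of P1, and sensors; $\Gamma_1,\Gamma_2\subseteq 2^\Sigma$ are P1's sensor queries and P2's sensor attacks; $\mathbf P:S\times A_1\to\mathcal D(S)$; $O\subseteq 2^S$; $\mathsf{Obs}:S\times\Gamma_1\times\Gamma_2\to O$ satisfies $s\in\mathsf{Obs}(s,\gamma_1,\gamma_2)$; $s_0\in o_0\in O$; $F\subseteq S$ is the set of goal states. P2 observes everything. Let $\sigma_0\in\Sigma$ be the hidden sensor, $\tau_r\in\mathbb N$ the delay in reaction, and $\epsilon\in(0,1)$. Put $\mathbf A_1=A_1\times\Gamma_1$, $\mathbf A_2=\Gamma_2$, $\mathbf A_1^2=\{(a,\gamma_1)\in\mathbf A_1:\sigma_0\notin\gamma_1\}$, $\mathbf A_2^2=\{\gamma_2\in\Gamma_2:\sigma_0\notin\gamma_2\}$, and assume that $\mathbf A_1^2$ and $\mathbf A_2^2$ are non-empty.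 For $B\subseteq S$ let $\mathsf{Post}(B,a)=\{s':\mathbf P(s,a,s')>0\text{ for some }s\in B\}$, and $\mathsf{Post}(s,a)=\mathsf{Post}(\{s\},a)$. **Sensor-revealing game $\mathcal H$.** Its states are a sink $q_F$ and the set $Q$ of the following states, where $B\subseteq S$, $\kappa\in\{-1,0,\dots,\tau_r\}$, $a\in A_1$, $\gamma_1\in\Gamma_1$: P1's states $(s,B,\kappa)$ with $s\in B$; nature's states $(s,B,a,\gamma_1,\kappa)$ with $\mathsf{Post}(s,a)\subseteq B$; P2's states $(s,B,\gamma_1,\kappa)$ with $s\in B$. Transitions: - At $(s,B,\kappa)$, P1 picks $(a,\gamma_1)\in\mathbf A_1$ and the game moves to $(s,\mathsf{Post}(B,a),a,\gamma_1,\kappa')$, where $\kappa'=\kappa$ if $\kappa=\tau_r$, or if $\kappa=-1$ and $\sigma_0\notin\gamma_1$, and $\kappa'=\kappa+1$ otherwise. - From $(s,B,a,\gamma_1,\kappa)$: if $\mathsf{Post}(s,a)\subseteq F$, the game moves to $q_F$; if $\mathsf{Post}(s,a)\cap F=\emptyset$, it moves to $(s',B,\gamma_1,\kappa)$ with probability $\mathbf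 P(s,a,s')$; otherwise it moves to $q_F$ with probability $\epsilon$ and to $(s',B,\gamma_1,\kappa)$ with probability $(1-\epsilon)\mathbf P(s,a,s')$. - At $(s,B,\gamma_1,\kappa)$, P2 picks $\gamma_2\in\mathbf A_2^2$ if $\kappa<\tau_r$, and $\gamma_2\in\mathbf A_2$ if $\kappa=\tau_r$; the game moves to $(s,B\cap\mathsf{Obs}(s,\gamma_1,\gamma_2),\kappa)$. P1's objective in $\mathcal H$ and in all the games below is to reach $q_F$. **Strategies and regions.** P1 uses randomized belief-based strategies: $\pi_1(s,B,\kappa)\in\mathcal D(\mathbf A_1)$ does not depend on $s$. P2 uses arbitrary randomized history-dependent strategies. For such a game and a set $\Pi$ of P2 strategies, say that $\pi_1$ *wins on* a set $W$ of states against $\Pi$ if $\pi_1$ plays only enabled actions at the P1 states of $W$; if $(s,B,\kappa)\in W$ and $s'\in B$ then $(s',B,\kappa)\in W$ (P1 knows only $B$, so the same strategy has to win whichever state of $B$ is the true one); and for every $\pi_2\in\Pi$, plays from $W$ stay in $W$ and from each state of $W$ reach $q_F$ with probability one. P1's almost-sure winning region against $\Pi$ is the union of all $W$ on which some belief-based $\pi_1$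 wins against $\Pi$; $\mathsf{ASW}_1(\mathcal G)$ is this region when $\Pi$ consists of all strategies of P2 in $\mathcal G$. A state is in $\mathsf{ASW}_2(\mathcal G)$ (resp. $\mathsf{PWin}_2(\mathcal G)$) if P2 has a strategy such that from this state, against every P1 strategy, $q_F$ is reached with probability $0$ (resp. $<1$). It is in $\mathsf{PWin}_1(\mathcal G)$ if P1 has a strategy such that from this state, against every P2 strategy, $q_F$ is reached with probability $>0$. P1's strategies in the definitions of $\mathsf{ASW}_2$, $\mathsf{PWin}_2$ and $\mathsf{PWin}_1$ are belief-based. For $(i,j)\in\{(1,2),(2,1)\}$ and a state $q$ of player $i$, the set $\mathsf{SR}_i(q,\mathcal G)$ of subjectively rationalizable actions consists of the actions $\alpha$ enabled at $q$ such that - all successors of $q$ under $\alpha$ lie in $\mathsf{ASW}_i(\mathcal G)$, if $q\in\mathsf{ASW}_i(\mathcal G)$; - not all successors of $q$ under $\alpha$ lie in $\mathsf{ASW}_j(\mathcal G)$, if $q\in\mathsf{PWin}_i(\mathcal G)\setminus\mathsf{ASW}_i(\mathcal G)$; with no further condition on $\alpha$ if $q\notin\mathsf{PWin}_i(\mathcal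 G)\cup\mathsf{ASW}_i(\mathcal G)$. **Derived games.** - The delay-attack game $\mathcal G^+$ is the part of $\mathcal H$ on $q_F$ and the states with $\kappa\ge 0$. - P2's perceptual game $\mathcal G^2$ is the part of $\mathcal H$ on $q_F$ and the states with $\kappa=-1$ (nature's states only with $(a,\gamma_1)\in\mathbf A_1^2$), with P1's actions restricted to $\mathbf A_1^2$ and P2's to $\mathbf A_2^2$. - The initial game $\mathcal G^0$ has as states $q_F$, the states of $Q$ with $\kappa=-1$, and nature's states with $\kappa=0$. Each state in $\mathsf{ASW}_1(\mathcal G^2)$ moves to $q_F$ with probability one; each state in $\mathsf{ASW}_2(\mathcal G^2)$ is absorbing. At every other state $q$: with $\kappa=-1$ the transitions are those of $\mathcal H$, where P1 may use the actions in $\mathsf{SR}_1(q,\mathcal G^2)\cup(\mathbf A_1\setminus\mathbf A_1^2)$ and P2 those in $\mathsf{SR}_2(q,\mathcal G^2)$; a nature state with $\kappa=0$ moves to $q_F$ if it is in $\mathsf{ASW}_1(\mathcal G^+)$, and is absorbing otherwise. **Deceptive region.** A strategy $\pi_2:Q\to\mathcal D(\mathbf A_2)$ of P2 (a function of the current state)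 is *behaviorally subjectively rationalizable* if at every P2 state $q$ the support of $\pi_2(q)$ is contained in $\mathsf{SR}_2(q,\mathcal G^2)$ when $\kappa=-1$ and in $\mathsf{SR}_2(q,\mathcal G^+)$ when $\kappa\ge 0$. The deceptive almost-sure winning region $\mathsf{DASW}_1(\mathcal H)$ is P1's almost-sure winning region in $\mathcal H$ against the set of behaviorally subjectively rationalizable strategies of P2. **Theorem.** $\displaystyle \mathsf{DASW}_1(\mathcal H)=\mathsf{ASW}_1(\mathcal G^0)\cup\mathsf{ASW}_1(\mathcal G^+).$ -/

import Mathlib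

open scoped ENNReal NNReal

namespace SensorReveal

/-! ## Stochastic reachability games with active sensing and sensor attacks -/

/-- The base game `G = (S, A₁, Σ, Γ₁, Γ₂, P, O, Obs, s₀, o₀, F)`. Observations are sets of states;
an observation of a state always contains that state. -/
structure SensingGame (S A Sen : Type*) where
  /-- sensor query actions of P1 -/
  Γ₁ : Set (Set Sen)
  /-- sensor attack actions of P2 -/
  Γ₂ : Set (Set Sen)
  /-- probabilistic transition function -/
  P : S → A → PMF S
  /-- observations -/
  O : Set (Set S)
  /-- observation function -/
  Obs : S → Γ₁ → Γ₂ → O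
  s₀ : S
  o₀ : O
  /-- goal states -/
  F : Set S
  s₀_mem : s₀ ∈ (o₀ : Set S)
  mem_obs : ∀ s γ₁ γ₂, s ∈ (Obs s γ₁ γ₂ : Set S)

/-- A base game together with the hidden sensor `σ₀`, the (finite) delay in reaction `τ`, and the
constant `ε ∈ (0, 1)` used in the construction of the sensor-revealing game. In P2's perceptual
game, in which `σ₀` does not exist, each player has at least one query/attack action. -/
structure HiddenSensorGame (S A Sen : Type*) extends SensingGame S A Sen where
  σ₀ : Sen
  τ : ℕ
  ε : ℝ≥0
  ε_pos : 0 < ε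
  ε_lt_one : ε < 1
  exists_known_query : ∃ γ₁ ∈ Γ₁, σ₀ ∉ γ₁
  exists_known_attack : ∃ γ₂ ∈ Γ₂, σ₀ ∉ γ₂

/-! ## Two-player stochastic games on belief-augmented states -/

/-- Belief-augmented states: P1's states `(s, B, κ)`, nature's states `(s, B, a, γ₁, κ)`,
P2's states `(s, B, γ₁, κ)`, and the final state `q_F`. `Qry` is the type of P1's queries. -/
inductive AState (S A Qry : Type*)
  | p1 (s : S) (B : Set S) (κ : ℤ)
  | nat (s : S) (B : Set S) (a : A) (γ₁ : Qry) (κ : ℤ)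
  | p2 (s : S) (B : Set S) (γ₁ : Qry) (κ : ℤ)
  | fin

/-- Moves: a control and sensing action of P1, an attack of P2, or a move of nature. -/
inductive Move (A Qry Atk : Type*)
  | one (m : A × Qry)
  | two (γ₂ : Atk)
  | nature

/-- A two-player stochastic game on a set `V` of belief-augmented states, with the actions that
are enabled for P1 and for P2 at each state (relevant at their own states only) and the
probabilistic transition function. P1's objective is to reach `AState.fin`. -/
structure Arena (S A Qry Atk : Type*) where
  V : Set (AState S A Qry)
  en₁ : AState S A Qry → Set (A × Qry)
  en₂ : AState S A Qry → Set Atk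
  δ : AState S A Qry → Move A Qry Atk → PMF (AState S A Qry)

/-- Prefixes of plays, up to the current state: the states visited and the moves taken there. -/
abbrev History (S A Qry Atk : Type*) := List (AState S A Qry × Move A Qry Atk)

/-- Randomized strategies of P1 on belief-augmented states. -/
abbrev Strategy₁ (S A Qry : Type*) := AState S A Qry → PMF (A × Qry)

/-- Randomized, history-dependent strategies of P2, who observes everything. The second argument
is the current state. -/
abbrev Strategy₂ (S A Qry Atk : Type*) := History S A Qry Atk → AState S A Qry → PMF Atk

section Arena

variable {S A Qry Atk : Type*}

/-- P1's strategy depends on a P1 state only through the belief and the counter. -/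
def BeliefBased (π₁ : Strategy₁ S A Qry) : Prop :=
  ∀ s s' B κ, π₁ (.p1 s B κ) = π₁ (.p1 s' B κ)

/-- `π₁` plays only enabled actions at the P1 states in `W`. -/
def PlaysEnabledOn (G : Arena S A Qry Atk) (W : Set (AState S A Qry)) (π₁ : Strategy₁ S A Qry) :
    Prop :=
  ∀ s B κ, .p1 s B κ ∈ W → (π₁ (.p1 s B κ)).support ⊆ G.en₁ (.p1 s B κ)

/-- P1's (belief-based) strategies in the game `G`. -/
def strategies₁ (G : Arena S A Qry Atk) : Set (Strategy₁ S A Qry) :=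
  {π₁ | BeliefBased π₁ ∧ PlaysEnabledOn G G.V π₁}

/-- P2's strategies in the game `G`: they play enabled actions at the P2 states of `G`. -/
def strategies₂ (G : Arena S A Qry Atk) : Set (Strategy₂ S A Qry Atk) :=
  {π₂ | ∀ h s B γ₁ κ, .p2 s B γ₁ κ ∈ G.V →
    (π₂ h (.p2 s B γ₁ κ)).support ⊆ G.en₂ (.p2 s B γ₁ κ)}

/-- The law of the next move after the history `h`, at the state `q`. -/
noncomputable def moveLaw (π₁ : Strategy₁ S A Qry) (π₂ : Strategy₂ S A Qry Atk)
    (h : History S A Qry Atk) (q : AState S A Qry) : PMF (Move A Qry Atk) :=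
  match q with
  | .p1 _ _ _ => (π₁ q).map Move.one
  | .p2 _ _ _ _ => (π₂ h q).map Move.two
  | .nat _ _ _ _ _ => PMF.pure Move.nature
  | .fin => PMF.pure Move.nature

open Classical in
/-- The probability that, after the history `h` and at the state `q`, the final state is visited
within the next `n` steps (the current state included). -/
noncomputable def reachWithin (G : Arena S A Qry Atk) (π₁ : Strategy₁ S A Qry)
    (π₂ : Strategy₂ S A Qry Atk) : ℕ → History S A Qry Atk → AState S A Qry → ℝ≥0∞
  | 0, _, q => if q = .fin then 1 else 0
  | n + 1, h, q =>
    if q = .fin then 1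
    else ∑' m, moveLaw π₁ π₂ h q m *
      ∑' q', G.δ q m q' * reachWithin G π₁ π₂ n (h ++ [(q, m)]) q'

/-- The probability that a play from `q` ever visits the final state: the limit of the increasing
sequence of the probabilities that it does so within `n` steps. -/
noncomputable def reachProb (G : Arena S A Qry Atk) (π₁ : Strategy₁ S A Qry)
    (π₂ : Strategy₂ S A Qry Atk) (q : AState S A Qry) : ℝ≥0∞ :=
  ⨆ n, reachWithin G π₁ π₂ n [] q

/-- A set of states is belief-closed if, with a P1 state `(s, B, κ)`, it contains all
the P1 states `(s', B, κ)` with `s' ∈ B`, which P1 cannot tell apart from it. -/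
def BeliefClosed (W : Set (AState S A Qry)) : Prop :=
  ∀ s B κ, .p1 s B κ ∈ W → ∀ s' ∈ B, .p1 s' B κ ∈ W

/-- Plays that follow `π₁` and `π₂` never leave `W`. -/
def StaysIn (G : Arena S A Qry Atk) (π₁ : Strategy₁ S A Qry) (π₂ : Strategy₂ S A Qry Atk)
    (W : Set (AState S A Qry)) : Prop :=
  ∀ h, ∀ q ∈ W, ∀ m ∈ (moveLaw π₁ π₂ h q).support, (G.δ q m).support ⊆ W

/-- `π₁` is a belief-based strategy that is almost-sure winning on the set `W` against all
strategies of P2 from `Adv`. P1 knows his belief, not the true state; so `W` is belief-closed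
and plays from `W` stay in `W`: at each P1 state that may be visited, one and the same strategy
wins with probability one whichever state of the belief is the true state. -/
structure WinsOn (G : Arena S A Qry Atk) (Adv : Set (Strategy₂ S A Qry Atk))
    (π₁ : Strategy₁ S A Qry) (W : Set (AState S A Qry)) : Prop where
  subset : W ⊆ G.V
  beliefBased : BeliefBased π₁
  enabled : PlaysEnabledOn G W π₁
  beliefClosed : BeliefClosed W
  staysIn : ∀ π₂ ∈ Adv, StaysIn G π₁ π₂ W
  wins : ∀ π₂ ∈ Adv, ∀ q ∈ W, reachProb G π₁ π₂ q = 1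

/-- The states from which P1 has a belief-based almost-sure winning strategy against all
strategies of P2 from `Adv`. -/
def winRegion (G : Arena S A Qry Atk) (Adv : Set (Strategy₂ S A Qry Atk)) :
    Set (AState S A Qry) :=
  {q | ∃ π₁ W, WinsOn G Adv π₁ W ∧ q ∈ W}

/-- P1's almost-sure winning region (with partial observations). -/
def ASW₁ (G : Arena S A Qry Atk) : Set (AState S A Qry) :=
  winRegion G (strategies₂ G)

/-- P2's almost-sure winning region. -/
def ASW₂ (G : Arena S A Qry Atk) : Set (AState S A Qry) :=
  {q ∈ G.V | ∃ π₂ ∈ strategies₂ G, ∀ π₁ ∈ strategies₁ G, reachProb G π₁ π₂ q = 0}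

/-- P1's positive winning region. -/
def PWin₁ (G : Arena S A Qry Atk) : Set (AState S A Qry) :=
  {q ∈ G.V | ∃ π₁ ∈ strategies₁ G, ∀ π₂ ∈ strategies₂ G, 0 < reachProb G π₁ π₂ q}

/-- P2's positive winning region. -/
def PWin₂ (G : Arena S A Qry Atk) : Set (AState S A Qry) :=
  {q ∈ G.V | ∃ π₂ ∈ strategies₂ G, ∀ π₁ ∈ strategies₁ G, reachProb G π₁ π₂ q < 1}

open Classical in
/-- P1's subjectively rationalizable actions in `G`. (No restriction at a state that is not even
positive winning for P1.) -/
noncomputable def SR₁ (G : Arena S A Qry Atk) (q : AState S A Qry) : Set (A × Qry) :=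
  if q ∈ ASW₁ G then {m ∈ G.en₁ q | (G.δ q (.one m)).support ⊆ ASW₁ G}
  else if q ∈ PWin₁ G then {m ∈ G.en₁ q | ¬ (G.δ q (.one m)).support ⊆ ASW₂ G}
  else G.en₁ q

open Classical in
/-- P2's subjectively rationalizable actions in `G`. (No restriction at a state that is not even
positive winning for P2.) -/
noncomputable def SR₂ (G : Arena S A Qry Atk) (q : AState S A Qry) : Set Atk :=
  if q ∈ ASW₂ G then {γ₂ ∈ G.en₂ q | (G.δ q (.two γ₂)).support ⊆ ASW₂ G}
  else if q ∈ PWin₂ G then {γ₂ ∈ G.en₂ q | ¬ (G.δ q (.two γ₂)).support ⊆ ASW₁ G}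
  else G.en₂ q

/-- The mixture `ε • p + (1 - ε) • r` of two distributions. -/
noncomputable def mix {α : Type*} (ε : ℝ≥0) (hε : ε ≤ 1) (p r : PMF α) : PMF α :=
  ⟨fun x => (ε : ℝ≥0∞) * p x + (1 - (ε : ℝ≥0∞)) * r x, by
    have h : ∑' x, ((ε : ℝ≥0∞) * p x + (1 - (ε : ℝ≥0∞)) * r x) = 1 := by
      rw [ENNReal.tsum_add, ENNReal.tsum_mul_left, ENNReal.tsum_mul_left, p.tsum_coe, r.tsum_coe,
        mul_one, mul_one]
      exact add_tsub_cancel_of_le (by exact_mod_cast hε)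
    have h' := ENNReal.summable.hasSum (f := fun x => (ε : ℝ≥0∞) * p x + (1 - (ε : ℝ≥0∞)) * r x)
    rwa [h] at h'⟩

end Arena

/-! ## The sensor-revealing game and the games derived from it -/

namespace HiddenSensorGame

variable {S A Sen : Type*} (D : HiddenSensorGame S A Sen)

/-- The states reachable in one step from a state of `B` under the control action `a`. -/
def Post (B : Set S) (a : A) : Set S := {s' | ∃ s ∈ B, s' ∈ (D.P s a).support}

/-- P1's actions `𝐀₁²` that are known to P2: those that do not query the hidden sensor. -/
def knownActs : Set (A × D.Γ₁) := {m | D.σ₀ ∉ (m.2 : Set Sen)}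

/-- P2's actions `𝐀₂²` in her own view: those that do not attack the hidden sensor. -/
def knownAtks : Set D.Γ₂ := {γ₂ | D.σ₀ ∉ (γ₂ : Set Sen)}

/-- The component `κ` of a state other than `q_F`. -/
def HasCounter (p : ℤ → Prop) : AState S A D.Γ₁ → Prop
  | .p1 _ _ κ => p κ
  | .nat _ _ _ _ κ => p κ
  | .p2 _ _ _ κ => p κ
  | .fin => False

/-- P1's belief is consistent with the true state. -/
def Consistent : AState S A D.Γ₁ → Prop
  | .p1 s B _ => s ∈ B
  | .nat s B a _ _ => D.Post {s} a ⊆ B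
  | .p2 s B _ _ => s ∈ B
  | .fin => True

/-- The states of the sensor-revealing game other than `q_F`: all those with a counter
`κ ∈ {-1, 0, …, τ}` in which P1's belief is consistent with the true state. -/
def Q : Set (AState S A D.Γ₁) :=
  {q | D.HasCounter (fun κ => -1 ≤ κ ∧ κ ≤ D.τ) q ∧ D.Consistent q}

open Classical in
/-- The counter after P1 queries `γ₁`: it is constant once it equals `τ`, stays at `-1` as long as
the hidden sensor is not queried, and grows by one otherwise. -/
noncomputable def nextCounter (κ : ℤ) (γ₁ : D.Γ₁) : ℤ :=
  if κ = D.τ then κ else if κ = -1 ∧ D.σ₀ ∉ (γ₁ : Set Sen) then κ else κ + 1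

open Classical in
/-- The move of nature at `(s, B, a, γ₁, κ)`. -/
noncomputable def natureLaw (s : S) (B : Set S) (a : A) (γ₁ : D.Γ₁) (κ : ℤ) :
    PMF (AState S A D.Γ₁) :=
  if D.Post {s} a ⊆ D.F then PMF.pure .fin
  else if D.Post {s} a ∩ D.F = ∅ then (D.P s a).map (fun s' => .p2 s' B γ₁ κ)
  else mix D.ε D.ε_lt_one.le (PMF.pure .fin) ((D.P s a).map (fun s' => .p2 s' B γ₁ κ))

/-- The transition function of the sensor-revealing game. The last case collects the final state,
which is a sink, and the moves that do not belong to the owner of the state. -/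
noncomputable def δ (q : AState S A D.Γ₁) (m : Move A D.Γ₁ D.Γ₂) : PMF (AState S A D.Γ₁) :=
  match q, m with
  | .p1 s B κ, .one (a, γ₁) => PMF.pure (.nat s (D.Post B a) a γ₁ (D.nextCounter κ γ₁))
  | .nat s B a γ₁ κ, .nature => D.natureLaw s B a γ₁ κ
  | .p2 s B γ₁ κ, .two γ₂ => PMF.pure (.p1 s (B ∩ (D.Obs s γ₁ γ₂ : Set S)) κ)
  | q, _ => PMF.pure q

open Classical in
/-- The sensor-revealing game `ℋ`. While `κ < τ`, P2 cannot attack the hidden sensor. -/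
noncomputable def H : Arena S A D.Γ₁ D.Γ₂ where
  V := D.Q ∪ {.fin}
  en₁ := fun _ => Set.univ
  en₂ := fun q => if D.HasCounter (fun κ => κ < D.τ) q then D.knownAtks else Set.univ
  δ := D.δ

/-- The delay-attack game `𝒢⁺`: the part of `ℋ` with `κ ≥ 0`. -/
noncomputable def Gplus : Arena S A D.Γ₁ D.Γ₂ where
  V := {q ∈ D.Q | D.HasCounter (fun κ => 0 ≤ κ) q} ∪ {.fin}
  en₁ := D.H.en₁
  en₂ := D.H.en₂
  δ := D.δ

/-- The states of P2's perceptual game other than `q_F`: those with `κ = -1`, where nature's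
states do not contain a query of the hidden sensor. -/
def Q2 : Set (AState S A D.Γ₁) :=
  {q ∈ D.Q | D.HasCounter (fun κ => κ = -1) q ∧
    ∀ s B a γ₁ κ, q = .nat s B a γ₁ κ → (a, γ₁) ∈ D.knownActs}

/-- The belief-augmented perceptual game `𝒢²` of P2. -/
noncomputable def G2 : Arena S A D.Γ₁ D.Γ₂ where
  V := D.Q2 ∪ {.fin}
  en₁ := fun _ => D.knownActs
  en₂ := fun _ => D.knownAtks
  δ := D.δ

/-- The states of the initial game other than `q_F`: those with `κ = -1`, and nature's states
with `κ = 0`. -/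
def Q0 : Set (AState S A D.Γ₁) :=
  {q ∈ D.Q | D.HasCounter (fun κ => κ = -1) q ∨ ∃ s B a γ₁, q = .nat s B a γ₁ 0}

open Classical in
/-- The transition function of the initial game: `ASW₁(𝒢²)` leads to `q_F`, `ASW₂(𝒢²)` is
absorbing, and so are nature's states with `κ = 0`, unless they lie in `ASW₁(𝒢⁺)`; these
lead to `q_F`. -/
noncomputable def δ0 (q : AState S A D.Γ₁) (m : Move A D.Γ₁ D.Γ₂) : PMF (AState S A D.Γ₁) :=
  if q ∈ ASW₁ D.G2 then PMF.pure .fin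
  else if q ∈ ASW₂ D.G2 then PMF.pure q
  else match q with
    | .nat s B a γ₁ κ =>
      if κ = 0 then
        if .nat s B a γ₁ κ ∈ ASW₁ D.Gplus then PMF.pure .fin else PMF.pure (.nat s B a γ₁ κ)
      else D.δ (.nat s B a γ₁ κ) m
    | q => D.δ q m

open Classical in
/-- The initial game `𝒢⁰`: outside `ASW₁(𝒢²) ∪ ASW₂(𝒢²)`, P1 plays subjectively rationalizable
actions or queries the hidden sensor, and P2 plays subjectively rationalizable actions. -/
noncomputable def G0 : Arena S A D.Γ₁ D.Γ₂ where
  V := D.Q0 ∪ {.fin}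
  en₁ := fun q => if q ∈ ASW₁ D.G2 ∪ ASW₂ D.G2 then Set.univ else SR₁ D.G2 q ∪ (D.knownActs)ᶜ
  en₂ := fun q => if q ∈ ASW₁ D.G2 ∪ ASW₂ D.G2 then D.knownAtks else SR₂ D.G2 q
  δ := D.δ0

/-- Behaviorally subjectively rationalizable strategies of P2 in `ℋ`: functions of the current
state that choose subjectively rationalizable actions in `𝒢²` as long as `κ = -1`, and in `𝒢⁺`
when `κ ≥ 0`. -/
def IsBSR (π₂ : AState S A D.Γ₁ → PMF D.Γ₂) : Prop :=
  ∀ s B γ₁ κ, .p2 s B γ₁ κ ∈ D.Q →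
    (κ = -1 → (π₂ (.p2 s B γ₁ κ)).support ⊆ SR₂ D.G2 (.p2 s B γ₁ κ)) ∧
    (0 ≤ κ → (π₂ (.p2 s B γ₁ κ)).support ⊆ SR₂ D.Gplus (.p2 s B γ₁ κ))

/-- P1's deceptive almost-sure winning region in `ℋ`. -/
def DASW₁ : Set (AState S A D.Γ₁) :=
  winRegion D.H {π₂ | ∃ f, D.IsBSR f ∧ π₂ = fun _ q => f q}

end HiddenSensorGame

end SensorReveal

namespace SensorReveal

/-! Almost-sure winning is reduced to a condition on the transition graph. If P2's class of
strategies consists of strategies playing in prescribed sets `E q` and contains all the memoryless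
ones, then P1's winning region is the largest set `W` that is closed under nature's moves, P2's
moves in `E` and indistinguishable states, and from each of whose states P1 reaches the goal with
positive probability by playing every action that is safe for his whole belief (`mem_winRegion_iff`,
`isWinSet_winRegion`). Both the history-dependent strategies and the rationalizable memoryless ones
form such a class, so only the sets of allowed actions matter.

Two facts then make the games comparable. An attack changes P1's belief but never the true state, so
in the perceptual game and in the delay-attack game P2 wins almost surely exactly where the goal is
unreachable in the base game (`IsSubgame.mem_ASW₂_iff`); no state of P1's deceptive region is of
this kind. Moreover, where the goal is reachable, an action that is not rationalizable for P2 leads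
into P1's winning region (`IsSubgame.support_subset_ASW₁_of_notMem_SR₂`), so restoring such actions
to P2 does P1 no harm.

Hence the part of the deceptive region with nonnegative counter is won in the delay-attack game. On
the part with counter `-1`, every safe action of P1 remains available in the initial game, and the
handover states with counter `0` lead to the goal there. Conversely, a winning set of the initial
game avoids the absorbing losing states; joined with the winning regions of the perceptual and the
delay-attack game, it is a winning set of the sensor-revealing game. -/

/-! ### Averages over distributions and uniform bounds -/

theorem le_tsum_pmf_mul {α : Type*} (p : PMF α) {f : α → ℝ≥0∞} {c : ℝ≥0∞}
    (h : ∀ a ∈ p.support, c ≤ f a) : c ≤ ∑' a, p a * f a :=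
  calc c = ∑' a, p a * c := by rw [ENNReal.tsum_mul_right, p.tsum_coe, one_mul]
    _ ≤ _ := ENNReal.tsum_le_tsum fun a => by
      by_cases h0 : p a = 0
      · simp [h0]
      · gcongr
        exact h a ((p.mem_support_iff a).2 h0)

theorem tsum_pmf_mul_le {α : Type*} (p : PMF α) {f : α → ℝ≥0∞} {c : ℝ≥0∞}
    (h : ∀ a, f a ≤ c) : ∑' a, p a * f a ≤ c :=
  calc ∑' a, p a * f a ≤ ∑' a, p a * c := ENNReal.tsum_le_tsum fun a => by gcongr; exact h a
    _ = c := by rw [ENNReal.tsum_mul_right, p.tsum_coe, one_mul]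

theorem add_mul_tsum_pmf_mul {α : Type*} (p : PMF α) (f : α → ℝ≥0∞) (x y : ℝ≥0∞) :
    x + y * ∑' a, p a * f a = ∑' a, p a * (x + y * f a) := by
  simp_rw [mul_add, ENNReal.tsum_add]
  rw [ENNReal.tsum_mul_right, p.tsum_coe, one_mul, ← ENNReal.tsum_mul_left]
  congr 1
  exact tsum_congr fun a => by ring

theorem exists_pmf_support_eq {α : Type*} [Finite α] (p₀ : PMF α) (X : Set α) :
    ∃ p : PMF α, (X.Nonempty → p.support = X) ∧ (¬ X.Nonempty → p = p₀) := by
  by_cases hX : X.Nonempty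
  · refine ⟨PMF.uniformOfFinset X.toFinite.toFinset (by simpa using hX), fun _ => ?_,
      fun h => absurd hX h⟩
    ext a
    simp
  · exact ⟨p₀, fun h => absurd h hX, fun _ => rfl⟩

/-- Take the largest time and the smallest constant. This serves twice: over P2's actions at one
state, and over the states of a finite winning set. -/
theorem exists_uniform_bound {ι : Type*} [Finite ι] (P : ι → ℕ → ℝ≥0∞ → Prop)
    (hP : ∀ i, ∃ n c, c ≠ 0 ∧ P i n c)
    (hmono : ∀ i n n' c c', n ≤ n' → c' ≤ c → P i n c → P i n' c') :
    ∃ n c, c ≠ 0 ∧ ∀ i, P i n c := by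
  classical
  cases nonempty_fintype ι
  choose n c hc h using hP
  refine ⟨Finset.univ.sup n, Finset.univ.inf c, ?_, fun i => hmono i _ _ _ _
    (Finset.le_sup (Finset.mem_univ i)) (Finset.inf_le (Finset.mem_univ i)) (h i)⟩
  refine ne_of_gt ((Finset.lt_inf_iff (by simp)).2 fun i _ => pos_iff_ne_zero.2 (hc i))

section Arena

variable {S A Qry Atk : Type*} {G : Arena S A Qry Atk} {π₁ : Strategy₁ S A Qry}
  {π₂ : Strategy₂ S A Qry Atk} {W : Set (AState S A Qry)} {q : AState S A Qry}

/-! ### Reachability probabilities -/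

theorem reachWithin_fin (n : ℕ) (h : History S A Qry Atk) :
    reachWithin G π₁ π₂ n h .fin = 1 := by
  cases n <;> simp [reachWithin]

theorem reachWithin_succ (hq : q ≠ .fin) (n : ℕ) (h : History S A Qry Atk) :
    reachWithin G π₁ π₂ (n + 1) h q = ∑' m, moveLaw π₁ π₂ h q m *
      ∑' q', G.δ q m q' * reachWithin G π₁ π₂ n (h ++ [(q, m)]) q' := by
  rw [reachWithin, if_neg hq]

theorem reachWithin_le_one (n : ℕ) (h : History S A Qry Atk) (q : AState S A Qry) :
    reachWithin G π₁ π₂ n h q ≤ 1 := by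
  induction n generalizing h q with
  | zero => rw [reachWithin]; split_ifs <;> simp
  | succ n ih =>
    by_cases hq : q = .fin
    · rw [hq, reachWithin_fin]
    · rw [reachWithin_succ hq]
      exact tsum_pmf_mul_le _ fun m => tsum_pmf_mul_le _ fun q' => ih _ _

theorem reachWithin_le_succ (n : ℕ) (h : History S A Qry Atk) (q : AState S A Qry) :
    reachWithin G π₁ π₂ n h q ≤ reachWithin G π₁ π₂ (n + 1) h q := by
  induction n generalizing h q with
  | zero =>
    by_cases hq : q = .fin
    · rw [hq, reachWithin_fin, reachWithin_fin]
    · rw [reachWithin, if_neg hq]; exact zero_le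
  | succ n ih =>
    by_cases hq : q = .fin
    · rw [hq, reachWithin_fin, reachWithin_fin]
    · rw [reachWithin_succ hq, reachWithin_succ hq]
      gcongr
      exact ih _ _

theorem reachWithin_mono (h : History S A Qry Atk) (q : AState S A Qry) :
    Monotone fun n => reachWithin G π₁ π₂ n h q :=
  monotone_nat_of_le_succ fun n => reachWithin_le_succ n h q

theorem mul_le_reachWithin_succ (hq : q ≠ .fin) {n : ℕ} {h : History S A Qry Atk}
    (m : Move A Qry Atk) (q' : AState S A Qry) :
    moveLaw π₁ π₂ h q m * (G.δ q m q' * reachWithin G π₁ π₂ n (h ++ [(q, m)]) q') ≤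
      reachWithin G π₁ π₂ (n + 1) h q := by
  rw [reachWithin_succ hq]
  refine le_trans ?_ (ENNReal.le_tsum m)
  gcongr
  exact ENNReal.le_tsum q'

theorem reachWithin_succ_ne_zero (hq : q ≠ .fin) {n : ℕ} {h : History S A Qry Atk}
    {m : Move A Qry Atk} {q' : AState S A Qry} (hm : m ∈ (moveLaw π₁ π₂ h q).support)
    (hq' : q' ∈ (G.δ q m).support)
    (hr : reachWithin G π₁ π₂ n (h ++ [(q, m)]) q' ≠ 0) :
    reachWithin G π₁ π₂ (n + 1) h q ≠ 0 := fun h0 => by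
  have := mul_le_reachWithin_succ (G := G) (π₁ := π₁) (π₂ := π₂) hq (n := n) (h := h) m q'
  rw [h0, nonpos_iff_eq_zero, mul_eq_zero, mul_eq_zero] at this
  rw [PMF.mem_support_iff] at hm hq'
  tauto

/-- From a set that is closed under the moves played and misses the final state, the final state
is not reached. -/
theorem reachWithin_eq_zero {T : Set (AState S A Qry)} (hfin : .fin ∉ T)
    (hT : StaysIn G π₁ π₂ T) (n : ℕ) (h : History S A Qry Atk) (hq : q ∈ T) :
    reachWithin G π₁ π₂ n h q = 0 := by
  induction n generalizing h q with
  | zero => rw [reachWithin, if_neg fun hf : q = .fin => hfin (hf ▸ hq)]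
  | succ n ih =>
    have hne : q ≠ .fin := fun hf => hfin (hf ▸ hq)
    rw [reachWithin_succ hne, ENNReal.tsum_eq_zero]
    intro m
    by_cases hm : moveLaw π₁ π₂ h q m = 0
    · rw [hm, zero_mul]
    rw [mul_eq_zero, ENNReal.tsum_eq_zero]
    refine Or.inr fun q' => ?_
    by_cases hq' : G.δ q m q' = 0
    · rw [hq', zero_mul]
    rw [ih _ (hT h q hq m ((PMF.mem_support_iff _ _).2 hm) ((PMF.mem_support_iff _ _).2 hq')),
      mul_zero]

theorem reachProb_eq_zero {T : Set (AState S A Qry)} (hfin : .fin ∉ T)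
    (hT : StaysIn G π₁ π₂ T) (hq : q ∈ T) : reachProb G π₁ π₂ q = 0 := by
  rw [reachProb, ENNReal.iSup_eq_zero]
  exact fun n => reachWithin_eq_zero hfin hT n _ hq

/-- Play `k` steps first. The plays that have reached the goal count fully, as `x + y = 1`; the
others are still in `W` and succeed within `n` more steps with probability at least `x`. -/
theorem add_mul_reachWithin_le (hW : StaysIn G π₁ π₂ W) {x y : ℝ≥0∞} (hxy : x + y = 1) {n : ℕ}
    (hx : ∀ h, ∀ q ∈ W, x ≤ reachWithin G π₁ π₂ n h q) (k : ℕ) (h : History S A Qry Atk)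
    (hq : q ∈ W) :
    x + y * reachWithin G π₁ π₂ k h q ≤ reachWithin G π₁ π₂ (n + k) h q := by
  induction k generalizing h q with
  | zero =>
    by_cases hf : q = .fin
    · rw [hf, reachWithin_fin, reachWithin_fin, mul_one, hxy]
    · rw [reachWithin, if_neg hf, mul_zero, add_zero]
      exact hx h q hq
  | succ k ih =>
    by_cases hf : q = .fin
    · rw [hf, reachWithin_fin, reachWithin_fin, mul_one, hxy]
    · rw [← add_assoc, reachWithin_succ hf, reachWithin_succ hf, add_mul_tsum_pmf_mul]
      refine ENNReal.tsum_le_tsum fun m => ?_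
      by_cases hm : moveLaw π₁ π₂ h q m = 0
      · simp [hm]
      gcongr
      rw [add_mul_tsum_pmf_mul]
      refine ENNReal.tsum_le_tsum fun q' => ?_
      by_cases hq' : G.δ q m q' = 0
      · simp [hq']
      gcongr
      exact ih _ (hW h q hq m ((PMF.mem_support_iff _ _).2 hm) ((PMF.mem_support_iff _ _).2 hq'))

/-- Each block of `N` steps succeeds with probability at least `c`, whatever the history, so `k`
blocks all fail with probability at most `(1 - c) ^ k`, which tends to zero. -/
theorem reachProb_eq_one (hW : StaysIn G π₁ π₂ W) {N : ℕ} {c : ℝ≥0∞} (hc : c ≠ 0)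
    (hN : ∀ h, ∀ q ∈ W, c ≤ reachWithin G π₁ π₂ N h q) (hq : q ∈ W) :
    reachProb G π₁ π₂ q = 1 := by
  have hc1 : c ≤ 1 := (hN [] q hq).trans (reachWithin_le_one _ _ _)
  have hr : c + (1 - c) = 1 := add_tsub_cancel_of_le hc1
  -- Here `x` is `1 - (1 - c) ^ k`, written as a sum to avoid truncated subtraction.
  have key : ∀ k : ℕ, ∃ n x, x + (1 - c) ^ k = 1 ∧
      ∀ h, ∀ q ∈ W, x ≤ reachWithin G π₁ π₂ n h q := by
    intro k
    induction k with
    | zero => exact ⟨0, 0, by simp, fun _ _ _ => zero_le⟩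
    | succ k ih =>
      obtain ⟨n, x, hx, h⟩ := ih
      refine ⟨n + N, x + (1 - c) ^ k * c, ?_, fun h' q hq => ?_⟩
      · rw [pow_succ, add_assoc, ← mul_add, hr, mul_one, hx]
      · refine le_trans ?_ (add_mul_reachWithin_le hW hx h N h' hq)
        gcongr
        exact hN h' q hq
  have h1 : ∀ k : ℕ, 1 ≤ reachProb G π₁ π₂ q + (1 - c) ^ k := by
    intro k
    obtain ⟨n, x, hx, h⟩ := key k
    refine hx.ge.trans ?_
    gcongr
    exact (h [] q hq).trans (le_iSup (fun n => reachWithin G π₁ π₂ n [] q) n)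
  refine le_antisymm (iSup_le fun n => reachWithin_le_one _ _ _) ?_
  have ht := (ENNReal.tendsto_pow_atTop_nhds_zero_of_lt_one
    (ENNReal.sub_lt_self (by simp) (by simp) hc : 1 - c < 1)).const_add (reachProb G π₁ π₂ q)
  rw [add_zero] at ht
  exact ge_of_tendsto' ht h1

/-! ### Winning sets -/

/-- The enabled actions of P1 that lead into `W` from every state of his belief. -/
def Safe (G : Arena S A Qry Atk) (W : Set (AState S A Qry)) (B : Set S) (κ : ℤ) :
    Set (A × Qry) :=
  {m | ∀ s ∈ B, m ∈ G.en₁ (.p1 s B κ) ∧ (G.δ (.p1 s B κ) (.one m)).support ⊆ W}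

/-- The states from which the final state is reached with positive probability when P1 plays all
his safe actions, whichever actions in `E` are played by P2. -/
inductive Attr (G : Arena S A Qry Atk) (E : AState S A Qry → Set Atk)
    (W : Set (AState S A Qry)) : AState S A Qry → Prop
  | fin : Attr G E W .fin
  | p1 {s B κ m q'} (hm : m ∈ Safe G W B κ) (hq' : q' ∈ (G.δ (.p1 s B κ) (.one m)).support)
      (h : Attr G E W q') : Attr G E W (.p1 s B κ)
  | nat {s B a γ₁ κ q'} (hq' : q' ∈ (G.δ (.nat s B a γ₁ κ) .nature).support)
      (h : Attr G E W q') : Attr G E W (.nat s B a γ₁ κ)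
  | p2 {s B γ₁ κ} (g : Atk → AState S A Qry)
      (hg : ∀ γ₂ ∈ E (.p2 s B γ₁ κ), g γ₂ ∈ (G.δ (.p2 s B γ₁ κ) (.two γ₂)).support)
      (h : ∀ γ₂ ∈ E (.p2 s B γ₁ κ), Attr G E W (g γ₂)) : Attr G E W (.p2 s B γ₁ κ)

variable {E : AState S A Qry → Set Atk} {Adv : Set (Strategy₂ S A Qry Atk)}

/-- The constructor `Attr.p2` carries its witnesses as a function, which gives one induction
hypothesis per action; choice supplies this function. -/
theorem Attr.of_forall_exists {s : S} {B : Set S} {γ₁ : Qry} {κ : ℤ}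
    (h : ∀ γ₂ ∈ E (.p2 s B γ₁ κ), ∃ q' ∈ (G.δ (.p2 s B γ₁ κ) (.two γ₂)).support, Attr G E W q') :
    Attr G E W (.p2 s B γ₁ κ) := by
  classical
  have : Nonempty (AState S A Qry) := ⟨.fin⟩
  have h' : ∀ γ₂, ∃ q', γ₂ ∈ E (.p2 s B γ₁ κ) →
      q' ∈ (G.δ (.p2 s B γ₁ κ) (.two γ₂)).support ∧ Attr G E W q' := fun γ₂ => by
    by_cases hγ : γ₂ ∈ E (.p2 s B γ₁ κ)
    · obtain ⟨q', h⟩ := h γ₂ hγ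
      exact ⟨q', fun _ => h⟩
    · exact ⟨.fin, fun h => absurd h hγ⟩
  choose g hg using h'
  exact .p2 g (fun γ₂ hγ => (hg γ₂ hγ).1) fun γ₂ hγ => (hg γ₂ hγ).2

theorem Safe.mono {W' : Set (AState S A Qry)} (hW : W ⊆ W') (B : Set S) (κ : ℤ) :
    Safe G W B κ ⊆ Safe G W' B κ :=
  fun _ hm s hs => ⟨(hm s hs).1, (hm s hs).2.trans hW⟩

theorem Attr.mono {W' : Set (AState S A Qry)} (hW : W ⊆ W') (h : Attr G E W q) :
    Attr G E W' q := by
  induction h with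
  | fin => exact .fin
  | p1 hm hq' _ ih => exact .p1 (Safe.mono hW _ _ hm) hq' ih
  | nat hq' _ ih => exact .nat hq' ih
  | p2 g hg _ ih => exact .p2 g hg ih

/-- Closed sets of states on which P1 can force the final state with positive probability. -/
structure IsWinSet (G : Arena S A Qry Atk) (E : AState S A Qry → Set Atk)
    (W : Set (AState S A Qry)) : Prop where
  subset : W ⊆ G.V
  beliefClosed : BeliefClosed W
  p2_closed : ∀ s B γ₁ κ, .p2 s B γ₁ κ ∈ W → ∀ γ₂ ∈ E (.p2 s B γ₁ κ),
    (G.δ (.p2 s B γ₁ κ) (.two γ₂)).support ⊆ W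
  nat_closed : ∀ s B a γ₁ κ, .nat s B a γ₁ κ ∈ W → (G.δ (.nat s B a γ₁ κ) .nature).support ⊆ W
  attr : ∀ q ∈ W, Attr G E W q

/-- `Adv` contains the memoryless strategies of P2 that choose actions in `E`, and only strategies
that choose actions in `E`. -/
structure IsLocalAdversary (G : Arena S A Qry Atk) (E : AState S A Qry → Set Atk)
    (Adv : Set (Strategy₂ S A Qry Atk)) : Prop where
  consistent : ∀ s B κ, .p1 s B κ ∈ G.V → s ∈ B
  sink : G.δ .fin .nature = PMF.pure .fin
  nonempty : ∀ s B γ₁ κ, .p2 s B γ₁ κ ∈ G.V → (E (.p2 s B γ₁ κ)).Nonempty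
  support_subset : ∀ π₂ ∈ Adv, ∀ h s B γ₁ κ, .p2 s B γ₁ κ ∈ G.V →
    (π₂ h (.p2 s B γ₁ κ)).support ⊆ E (.p2 s B γ₁ κ)
  memoryless_mem : ∀ f : AState S A Qry → PMF Atk, (∀ s B γ₁ κ, .p2 s B γ₁ κ ∈ G.V →
    (f (.p2 s B γ₁ κ)).support ⊆ E (.p2 s B γ₁ κ)) → (fun _ q => f q) ∈ Adv

/-- Enlarging `W` only adds safe actions, so positive reachability survives in the union. This gives
a largest winning set. -/
theorem IsWinSet.sUnion {C : Set (Set (AState S A Qry))} (hC : ∀ W ∈ C, IsWinSet G E W) :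
    IsWinSet G E (⋃₀ C) where
  subset := Set.sUnion_subset fun W hW => (hC W hW).subset
  beliefClosed := fun s B κ ⟨W, hW, h⟩ s' hs' => ⟨W, hW, (hC W hW).beliefClosed s B κ h s' hs'⟩
  p2_closed := fun s B γ₁ κ ⟨W, hW, h⟩ γ₂ hγ =>
    ((hC W hW).p2_closed s B γ₁ κ h γ₂ hγ).trans (Set.subset_sUnion_of_mem hW)
  nat_closed := fun s B a γ₁ κ ⟨W, hW, h⟩ =>
    ((hC W hW).nat_closed s B a γ₁ κ h).trans (Set.subset_sUnion_of_mem hW)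
  attr := fun q ⟨W, hW, h⟩ => ((hC W hW).attr q h).mono (Set.subset_sUnion_of_mem hW)

/-- The bound is uniform in the history because P1 is memoryless and, at P2's states, the worst of
finitely many actions is taken. -/
theorem Attr.exists_le_reachWithin [Finite Atk] (hW : IsWinSet G E W)
    (hcons : ∀ s B κ, .p1 s B κ ∈ W → s ∈ B)
    (hπ₁ : ∀ s B κ, .p1 s B κ ∈ W → Safe G W B κ ⊆ (π₁ (.p1 s B κ)).support)
    (hπ₂ : ∀ h s B γ₁ κ, .p2 s B γ₁ κ ∈ W →
      (π₂ h (.p2 s B γ₁ κ)).support ⊆ E (.p2 s B γ₁ κ))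
    (ha : Attr G E W q) (hq : q ∈ W) :
    ∃ n c, c ≠ 0 ∧ ∀ h, c ≤ reachWithin G π₁ π₂ n h q := by
  induction ha with
  | fin => exact ⟨0, 1, one_ne_zero, fun h => (reachWithin_fin 0 h).ge⟩
  | @p1 s B κ m q' hm hq' _ ih =>
    obtain ⟨n, c, hc, h⟩ := ih ((hm s (hcons s B κ hq)).2 hq')
    refine ⟨n + 1, π₁ (.p1 s B κ) m * (G.δ (.p1 s B κ) (.one m) q' * c),
      mul_ne_zero ((PMF.mem_support_iff _ _).1 (hπ₁ s B κ hq hm))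
        (mul_ne_zero ((PMF.mem_support_iff _ _).1 hq') hc), fun h' => ?_⟩
    refine le_trans ?_ (mul_le_reachWithin_succ (by simp) (.one m) q')
    have : π₁ (.p1 s B κ) m ≤ moveLaw π₁ π₂ h' (.p1 s B κ) (.one m) := by
      rw [moveLaw, PMF.map_apply]
      refine le_trans ?_ (ENNReal.le_tsum m)
      simp
    gcongr
    exact h _
  | @nat s B a γ₁ κ q' hq' _ ih =>
    obtain ⟨n, c, hc, h⟩ := ih (hW.nat_closed _ _ _ _ _ hq hq')
    refine ⟨n + 1, G.δ (.nat s B a γ₁ κ) .nature q' * c,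
      mul_ne_zero ((PMF.mem_support_iff _ _).1 hq') hc, fun h' => ?_⟩
    refine le_trans ?_ (mul_le_reachWithin_succ (by simp) .nature q')
    rw [moveLaw, PMF.pure_apply_self, one_mul]
    gcongr
    exact h _
  | @p2 s B γ₁ κ g hg _ ih =>
    obtain ⟨n, c, hc, h⟩ := exists_uniform_bound (ι := Atk)
      (fun γ₂ n c => γ₂ ∈ E (.p2 s B γ₁ κ) →
        ∀ h, c ≤ G.δ (.p2 s B γ₁ κ) (.two γ₂) (g γ₂) * reachWithin G π₁ π₂ n h (g γ₂))
      (fun γ₂ => by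
        by_cases hγ : γ₂ ∈ E (.p2 s B γ₁ κ)
        · obtain ⟨n, c, hc, h⟩ := ih γ₂ hγ (hW.p2_closed _ _ _ _ hq γ₂ hγ (hg γ₂ hγ))
          refine ⟨n, G.δ (.p2 s B γ₁ κ) (.two γ₂) (g γ₂) * c,
            mul_ne_zero ((PMF.mem_support_iff _ _).1 (hg γ₂ hγ)) hc, fun _ h' => ?_⟩
          gcongr
          exact h h'
        · exact ⟨0, 1, one_ne_zero, fun h => absurd h hγ⟩)
      (fun γ₂ n n' c c' hn hc h hγ h' => by
        refine hc.trans ((h hγ h').trans ?_)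
        gcongr
        exact reachWithin_mono _ _ hn)
    refine ⟨n + 1, c, hc, fun h' => ?_⟩
    rw [reachWithin_succ (by simp)]
    refine le_tsum_pmf_mul _ fun m hm => ?_
    rw [moveLaw, PMF.support_map] at hm
    obtain ⟨γ₂, hγ, rfl⟩ := hm
    exact (h γ₂ (hπ₂ _ _ _ _ _ hq hγ) _).trans (ENNReal.le_tsum _)

/-- On a winning set, P1 wins by playing all the safe actions. -/
theorem IsWinSet.exists_winsOn [Finite Atk] [Finite A] [Finite Qry]
    (hA : IsLocalAdversary G E Adv) (hfin : G.V.Finite) (hW : IsWinSet G E W)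
    (p₀ : PMF (A × Qry)) :
    ∃ π₁, WinsOn G Adv π₁ W ∧ ∀ s B κ, s ∈ B →
      (π₁ (.p1 s B κ)).support ⊆ G.en₁ (.p1 s B κ) ∨ π₁ (.p1 s B κ) = p₀ := by
  choose u hu hu' using exists_pmf_support_eq p₀
  let π₁ : Strategy₁ S A Qry := fun q => match q with
    | .p1 _ B κ => u (Safe G W B κ)
    | _ => p₀
  have hcons : ∀ s B κ, .p1 s B κ ∈ W → s ∈ B := fun s B κ h =>
    hA.consistent s B κ (hW.subset h)
  have hsupp : ∀ s B κ, .p1 s B κ ∈ W → (π₁ (.p1 s B κ)).support = Safe G W B κ := by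
    intro s B κ h
    refine hu _ ?_
    cases hW.attr _ h with
    | p1 hm _ _ => exact ⟨_, hm⟩
  have hstay : ∀ π₂ ∈ Adv, StaysIn G π₁ π₂ W := by
    intro π₂ hπ₂ h q hq m hm
    cases q with
    | p1 s B κ =>
      rw [moveLaw, PMF.support_map] at hm
      obtain ⟨m, hm, rfl⟩ := hm
      rw [hsupp s B κ hq] at hm
      exact (hm s (hcons s B κ hq)).2
    | nat s B a γ₁ κ =>
      rw [moveLaw, PMF.mem_support_pure_iff] at hm
      subst hm
      exact hW.nat_closed _ _ _ _ _ hq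
    | p2 s B γ₁ κ =>
      rw [moveLaw, PMF.support_map] at hm
      obtain ⟨γ₂, hγ, rfl⟩ := hm
      exact hW.p2_closed _ _ _ _ hq _ (hA.support_subset π₂ hπ₂ _ _ _ _ _ (hW.subset hq) hγ)
    | fin =>
      rw [moveLaw, PMF.mem_support_pure_iff] at hm
      subst hm
      rw [hA.sink, PMF.support_pure, Set.singleton_subset_iff]
      exact hq
  refine ⟨π₁, ⟨hW.subset, fun _ _ _ _ => rfl, ?_, hW.beliefClosed, hstay, ?_⟩, ?_⟩
  · intro s B κ h m hm
    rw [hsupp s B κ h] at hm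
    exact (hm s (hcons s B κ h)).1
  · intro π₂ hπ₂ q hq
    have : Finite W := hfin.subset hW.subset
    obtain ⟨N, c, hc, h⟩ := exists_uniform_bound (ι := W)
      (fun q n c => ∀ h, c ≤ reachWithin G π₁ π₂ n h q)
      (fun q => (hW.attr q q.2).exists_le_reachWithin hW hcons (fun s B κ h => (hsupp s B κ h).ge)
        (fun h s B γ₁ κ hq => hA.support_subset π₂ hπ₂ h s B γ₁ κ (hW.subset hq)) q.2)
      (fun q n n' c c' hn hc h h' => hc.trans ((h h').trans (reachWithin_mono _ _ hn)))
    exact reachProb_eq_one (hstay π₂ hπ₂) hc (fun h' q hq => h ⟨q, hq⟩ h') hq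
  · intro s B κ hs
    by_cases hne : (Safe G W B κ).Nonempty
    · left
      intro m hm
      have : (π₁ (.p1 s B κ)).support = Safe G W B κ := hu _ hne
      rw [this] at hm
      exact (hm s hs).1
    · exact Or.inr (hu' _ hne)

/-- Deterministic memoryless replies of P2 suffice. They test closedness one action at a time; and
if some state of `W` were not in `Attr`, one of them would keep the play among such states forever,
contradicting the win. -/
theorem WinsOn.isWinSet [Nonempty Atk] (hA : IsLocalAdversary G E Adv)
    (hw : WinsOn G Adv π₁ W) : IsWinSet G E W := by
  classical
  have hmem : ∀ Good : AState S A Qry → Set Atk, ∃ g : AState S A Qry → Atk,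
      (∀ q, (E q ∩ Good q).Nonempty → g q ∈ Good q) ∧
      (fun _ q => PMF.pure (g q)) ∈ Adv := by
    intro Good
    -- Where no allowed action is good, any allowed one is taken, so that the strategy stays in
    -- `Adv`.
    have : ∀ q, ∃ γ₂, ((E q ∩ Good q).Nonempty → γ₂ ∈ Good q) ∧
        ((E q).Nonempty → γ₂ ∈ E q) := by
      intro q
      by_cases h1 : (E q ∩ Good q).Nonempty
      · obtain ⟨γ₂, h, h'⟩ := h1
        exact ⟨γ₂, fun _ => h', fun _ => h⟩
      · by_cases h2 : (E q).Nonempty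
        · exact ⟨h2.some, fun h => absurd h h1, fun h => h.some_mem⟩
        · exact ⟨Classical.arbitrary _, fun h => absurd h h1, fun h => absurd h h2⟩
    choose g hg hg' using this
    refine ⟨g, hg, hA.memoryless_mem _ fun s B γ₁ κ h => ?_⟩
    rw [PMF.support_pure, Set.singleton_subset_iff]
    exact hg' _ (hA.nonempty s B γ₁ κ h)
  obtain ⟨g₀, -, hg₀⟩ := hmem fun _ => ∅
  have hsafe : ∀ s B κ, .p1 s B κ ∈ W → (π₁ (.p1 s B κ)).support ⊆ Safe G W B κ := by
    intro s B κ h m hm s' hs'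
    have h' := hw.beliefClosed s B κ h s' hs'
    rw [hw.beliefBased s s' B κ] at hm
    refine ⟨hw.enabled s' B κ h' hm, hw.staysIn _ hg₀ [] _ h' _ ?_⟩
    rw [moveLaw, PMF.support_map]
    exact ⟨m, hm, rfl⟩
  refine ⟨hw.subset, hw.beliefClosed, ?_, ?_, ?_⟩
  · intro s B γ₁ κ h γ₂ hγ
    obtain ⟨g, hg, hgA⟩ := hmem fun _ => {γ₂}
    refine hw.staysIn _ hgA [] _ h _ ?_
    rw [moveLaw, PMF.support_map, PMF.support_pure, hg _ ⟨γ₂, hγ, rfl⟩]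
    simp
  · intro s B a γ₁ κ h
    refine hw.staysIn _ hg₀ [] _ h _ ?_
    rw [moveLaw, PMF.mem_support_pure_iff]
  · intro q hq
    by_contra hna
    -- Good actions are those with no successor in `Attr`; a P2 state outside `Attr` always has an
    -- allowed one.
    obtain ⟨g, hg, hgA⟩ := hmem fun q =>
      {γ₂ | ∀ q' ∈ (G.δ q (.two γ₂)).support, ¬ Attr G E W q'}
    have hT : StaysIn G π₁ (fun _ q => PMF.pure (g q)) {q ∈ W | ¬ Attr G E W q} := by
      intro h q ⟨hq, hna⟩ m hm q' hq'
      refine ⟨hw.staysIn _ hgA h q hq m hm hq', fun ha => ?_⟩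
      cases q with
      | p1 s B κ =>
        rw [moveLaw, PMF.support_map] at hm
        obtain ⟨m, hm, rfl⟩ := hm
        exact hna (.p1 (hsafe s B κ hq hm) hq' ha)
      | nat s B a γ₁ κ =>
        rw [moveLaw, PMF.mem_support_pure_iff] at hm
        subst hm
        exact hna (.nat hq' ha)
      | p2 s B γ₁ κ =>
        rw [moveLaw, PMF.support_map, PMF.support_pure, Set.image_singleton] at hm
        obtain rfl := hm
        refine hg (.p2 s B γ₁ κ) ?_ q' hq' ha
        by_contra hne
        refine hna (.of_forall_exists fun γ₂ hγ => ?_)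
        by_contra hno
        push Not at hno
        exact hne ⟨γ₂, hγ, hno⟩
      | fin => exact hna .fin
    have := hw.wins _ hgA q hq
    rw [reachProb_eq_zero (fun h => h.2 .fin) hT ⟨hq, hna⟩] at this
    exact zero_ne_one this

theorem mem_winRegion_iff [Finite Atk] [Nonempty Atk] [Finite A] [Finite Qry] [Nonempty A]
    [Nonempty Qry] (hA : IsLocalAdversary G E Adv) (hfin : G.V.Finite) :
    q ∈ winRegion G Adv ↔ ∃ W, IsWinSet G E W ∧ q ∈ W := by
  constructor
  · rintro ⟨π₁, W, hw, hq⟩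
    exact ⟨W, hw.isWinSet hA, hq⟩
  · rintro ⟨W, hW, hq⟩
    obtain ⟨π₁, hw, -⟩ := hW.exists_winsOn hA hfin (PMF.pure (Classical.arbitrary _))
    exact ⟨π₁, W, hw, hq⟩

theorem isWinSet_winRegion [Finite Atk] [Nonempty Atk] [Finite A] [Finite Qry] [Nonempty A]
    [Nonempty Qry] (hA : IsLocalAdversary G E Adv) (hfin : G.V.Finite) :
    IsWinSet G E (winRegion G Adv) := by
  have : winRegion G Adv = ⋃₀ {W | IsWinSet G E W} := by
    ext q
    rw [mem_winRegion_iff hA hfin]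
    rfl
  rw [this]
  exact .sUnion fun W hW => hW

theorem IsWinSet.subset_winRegion [Finite Atk] [Nonempty Atk] [Finite A] [Finite Qry]
    [Nonempty A] [Nonempty Qry] (hA : IsLocalAdversary G E Adv) (hfin : G.V.Finite)
    (hW : IsWinSet G E W) : W ⊆ winRegion G Adv :=
  fun _ hq => (mem_winRegion_iff hA hfin).2 ⟨W, hW, hq⟩

theorem isLocalAdversary_strategies₂ (hcons : ∀ s B κ, .p1 s B κ ∈ G.V → s ∈ B)
    (hsink : G.δ .fin .nature = PMF.pure .fin)
    (hne : ∀ s B γ₁ κ, .p2 s B γ₁ κ ∈ G.V → (G.en₂ (.p2 s B γ₁ κ)).Nonempty) :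
    IsLocalAdversary G G.en₂ (strategies₂ G) where
  consistent := hcons
  sink := hsink
  nonempty := hne
  support_subset := fun _ hπ₂ => hπ₂
  memoryless_mem := fun _ hf _ => hf

theorem SR₂_subset (q : AState S A Qry) : SR₂ G q ⊆ G.en₂ q := by
  unfold SR₂
  split_ifs
  · exact Set.sep_subset _ _
  · exact Set.sep_subset _ _
  · exact subset_rfl

end Arena


namespace HiddenSensorGame

variable {S A Sen : Type*} (D : HiddenSensorGame S A Sen)

/-! ### Reachability of the goal in the base game -/

/-- The goal can be reached from `s`, after at least one step. -/
inductive Live : S → Prop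
  | now {s a s'} (h : s' ∈ (D.P s a).support) (hF : s' ∈ D.F) : Live s
  | step {s a s'} (h : s' ∈ (D.P s a).support) (hs' : Live s') : Live s

/-- Belief-augmented states from which the goal can be reached. -/
def LiveState : AState S A D.Γ₁ → Prop
  | .p1 s _ _ => D.Live s
  | .nat s _ a _ _ => ∃ s' ∈ (D.P s a).support, s' ∈ D.F ∨ D.Live s'
  | .p2 s _ _ _ => D.Live s
  | .fin => True

variable {D}

theorem mem_Post_singleton {s s' : S} {a : A} :
    s' ∈ D.Post {s} a ↔ s' ∈ (D.P s a).support := by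
  simp [Post]

theorem mem_support_mix_left {α : Type*} {ε : ℝ≥0} (h0 : 0 < ε) (h : ε < 1) {p r : PMF α} {x : α}
    (hx : x ∈ p.support) : x ∈ (mix ε h.le p r).support := by
  rw [PMF.mem_support_iff] at hx ⊢
  change (ε : ℝ≥0∞) * p x + (1 - (ε : ℝ≥0∞)) * r x ≠ 0
  simp [hx, h0.ne']

theorem mem_support_of_mem_support_mix {α : Type*} {ε : ℝ≥0} {h : ε ≤ 1} {p r : PMF α} {x : α}
    (hx : x ∈ (mix ε h p r).support) : x ∈ p.support ∨ x ∈ r.support := by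
  simp_rw [PMF.mem_support_iff] at hx ⊢
  change (ε : ℝ≥0∞) * p x + (1 - (ε : ℝ≥0∞)) * r x ≠ 0 at hx
  by_contra! hc
  simp [hc.1, hc.2] at hx

theorem of_mem_support_natureLaw {s : S} {B : Set S} {a : A} {γ₁ : D.Γ₁} {κ : ℤ}
    {q : AState S A D.Γ₁} (h : q ∈ (D.natureLaw s B a γ₁ κ).support) :
    (q = .fin ∧ ∃ s' ∈ (D.P s a).support, s' ∈ D.F) ∨
      ∃ s' ∈ (D.P s a).support, q = .p2 s' B γ₁ κ := by
  unfold natureLaw at h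
  split_ifs at h with h1 h2
  · obtain ⟨s', hs'⟩ := (D.P s a).support_nonempty
    exact Or.inl ⟨(PMF.mem_support_pure_iff _ _).1 h, s', hs', h1 (mem_Post_singleton.2 hs')⟩
  · rw [PMF.support_map] at h
    obtain ⟨s', hs', rfl⟩ := h
    exact Or.inr ⟨s', hs', rfl⟩
  · rcases mem_support_of_mem_support_mix h with h | h
    · obtain ⟨s', hs', hF⟩ := Set.nonempty_iff_ne_empty.2 h2
      exact Or.inl ⟨(PMF.mem_support_pure_iff _ _).1 h, s', mem_Post_singleton.1 hs', hF⟩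
    · rw [PMF.support_map] at h
      obtain ⟨s', hs', rfl⟩ := h
      exact Or.inr ⟨s', hs', rfl⟩

theorem fin_mem_support_natureLaw {s s' : S} {B : Set S} {a : A} {γ₁ : D.Γ₁} {κ : ℤ}
    (hs' : s' ∈ (D.P s a).support) (hF : s' ∈ D.F) :
    .fin ∈ (D.natureLaw s B a γ₁ κ).support := by
  unfold natureLaw
  split_ifs with h1 h2
  · simp
  · exact absurd h2 (Set.nonempty_iff_ne_empty.1 ⟨s', mem_Post_singleton.2 hs', hF⟩)
  · exact mem_support_mix_left D.ε_pos D.ε_lt_one (by simp)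

theorem p2_mem_support_natureLaw {s s' : S} {B : Set S} {a : A} {γ₁ : D.Γ₁} {κ : ℤ}
    (hs' : s' ∈ (D.P s a).support) (hF : ∀ s' ∈ (D.P s a).support, s' ∉ D.F) :
    .p2 s' B γ₁ κ ∈ (D.natureLaw s B a γ₁ κ).support := by
  unfold natureLaw
  split_ifs with h1 h2
  · exact absurd (h1 (mem_Post_singleton.2 hs')) (hF s' hs')
  · rw [PMF.support_map]
    exact ⟨s', hs', rfl⟩
  · obtain ⟨s'', h, h'⟩ := Set.nonempty_iff_ne_empty.2 h2
    exact absurd h' (hF _ (mem_Post_singleton.1 h))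

theorem liveState_of_mem_support_δ {q q' : AState S A D.Γ₁} {m : Move A D.Γ₁ D.Γ₂}
    (hq' : q' ∈ (D.δ q m).support) (h : D.LiveState q') : D.LiveState q := by
  unfold δ at hq'
  split at hq'
  · rw [PMF.mem_support_pure_iff] at hq'
    subst hq'
    obtain ⟨s', hs', hF | hl⟩ := h
    · exact .now hs' hF
    · exact .step hs' hl
  · rcases of_mem_support_natureLaw hq' with ⟨-, s', hs', hF⟩ | ⟨s', hs', rfl⟩
    · exact ⟨s', hs', Or.inl hF⟩
    · exact ⟨s', hs', Or.inr h⟩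
  · rw [PMF.mem_support_pure_iff] at hq'
    subst hq'
    exact h
  · rw [PMF.mem_support_pure_iff] at hq'
    exact hq' ▸ h

theorem liveState_of_reachProb_ne_zero {G : Arena S A D.Γ₁ D.Γ₂} (hδ : G.δ = D.δ)
    {π₁ : Strategy₁ S A D.Γ₁} {π₂ : Strategy₂ S A D.Γ₁ D.Γ₂} {q : AState S A D.Γ₁}
    (h : reachProb G π₁ π₂ q ≠ 0) : D.LiveState q := by
  by_contra hq
  refine h (reachProb_eq_zero (T := {q | ¬ D.LiveState q}) (fun h => h trivial) ?_ hq)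
  intro _ q hq m _ q' hq' hl
  rw [hδ] at hq'
  exact hq (liveState_of_mem_support_δ hq' hl)

/-- A path to the goal in the base game can be followed with a fixed known query: P1 gives its
actions positive weight, and whatever P2 attacks, the true state is unchanged. -/
theorem Live.exists_reachWithin_ne_zero {G : Arena S A D.Γ₁ D.Γ₂} (hδ : G.δ = D.δ)
    {π₁ : Strategy₁ S A D.Γ₁} (hπ₁ : ∀ q, D.knownActs ⊆ (π₁ q).support)
    {π₂ : Strategy₂ S A D.Γ₁ D.Γ₂} {s : S} (hs : D.Live s) :
    (∀ B κ h, ∃ n, reachWithin G π₁ π₂ n h (.p1 s B κ) ≠ 0) ∧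
    (∀ B γ₁ κ h, ∃ n, reachWithin G π₁ π₂ n h (.p2 s B γ₁ κ) ≠ 0) := by
  obtain ⟨γ, hγ, hγσ⟩ := D.exists_known_query
  have fin_step : ∀ s B a γ₁ κ h, (∃ s' ∈ (D.P s a).support, s' ∈ D.F) →
      ∃ n, reachWithin G π₁ π₂ n h (.nat s B a γ₁ κ) ≠ 0 := by
    rintro s B a γ₁ κ h ⟨s', hs', hF⟩
    refine ⟨0 + 1, reachWithin_succ_ne_zero (by simp) (m := .nature) (q' := .fin) ?_ ?_ ?_⟩
    · simp [moveLaw]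
    · rw [hδ]
      exact fin_mem_support_natureLaw hs' hF
    · rw [reachWithin_fin]
      exact one_ne_zero
  have p1_step : ∀ s a, (∀ B γ₁ κ h, ∃ n, reachWithin G π₁ π₂ n h (.nat s B a γ₁ κ) ≠ 0) →
      ∀ B κ h, ∃ n, reachWithin G π₁ π₂ n h (.p1 s B κ) ≠ 0 := by
    intro s a H B κ h
    obtain ⟨n, hn⟩ := H (D.Post B a) ⟨γ, hγ⟩ (D.nextCounter κ ⟨γ, hγ⟩)
      (h ++ [(.p1 s B κ, .one (a, ⟨γ, hγ⟩))])
    refine ⟨n + 1, reachWithin_succ_ne_zero (by simp) (m := .one (a, ⟨γ, hγ⟩)) ?_ ?_ hn⟩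
    · rw [moveLaw, PMF.support_map]
      exact ⟨_, hπ₁ _ hγσ, rfl⟩
    · rw [hδ]
      simp [δ]
  have p2_step : ∀ s, (∀ B κ h, ∃ n, reachWithin G π₁ π₂ n h (.p1 s B κ) ≠ 0) →
      ∀ B γ₁ κ h, ∃ n, reachWithin G π₁ π₂ n h (.p2 s B γ₁ κ) ≠ 0 := by
    intro s H B γ₁ κ h
    obtain ⟨γ₂, hγ₂⟩ := (π₂ h (.p2 s B γ₁ κ)).support_nonempty
    obtain ⟨n, hn⟩ := H (B ∩ (D.Obs s γ₁ γ₂ : Set S)) κ (h ++ [(.p2 s B γ₁ κ, .two γ₂)])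
    refine ⟨n + 1, reachWithin_succ_ne_zero (by simp) (m := .two γ₂) ?_ ?_ hn⟩
    · rw [moveLaw, PMF.support_map]
      exact ⟨_, hγ₂, rfl⟩
    · rw [hδ]
      simp [δ]
  suffices h : ∀ B κ h, ∃ n, reachWithin G π₁ π₂ n h (.p1 s B κ) ≠ 0 from ⟨h, p2_step s h⟩
  induction hs with
  | @now s a s' hs' hF => exact p1_step s a fun B γ₁ κ h => fin_step _ _ _ _ _ _ ⟨s', hs', hF⟩
  | @step s a s' hs' _ ih =>
    refine p1_step s a fun B γ₁ κ h => ?_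
    -- If some successor is a goal state, nature may jump to the final state, and need not be able
    -- to move to `s'` at all; otherwise every successor is a possible move.
    by_cases hF : ∃ s' ∈ (D.P s a).support, s' ∈ D.F
    · exact fin_step _ _ _ _ _ _ hF
    push Not at hF
    obtain ⟨n, hn⟩ := p2_step s' ih B γ₁ κ (h ++ [(.nat s B a γ₁ κ, .nature)])
    refine ⟨n + 1, reachWithin_succ_ne_zero (by simp) (m := .nature) ?_ ?_ hn⟩
    · simp [moveLaw]
    · rw [hδ]
      exact p2_mem_support_natureLaw hs' hF

theorem LiveState.reachProb_ne_zero {G : Arena S A D.Γ₁ D.Γ₂} (hδ : G.δ = D.δ)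
    {π₁ : Strategy₁ S A D.Γ₁} (hπ₁ : ∀ q, D.knownActs ⊆ (π₁ q).support)
    {π₂ : Strategy₂ S A D.Γ₁ D.Γ₂} {q : AState S A D.Γ₁} (hq : D.LiveState q) :
    reachProb G π₁ π₂ q ≠ 0 := by
  suffices h : ∃ n, reachWithin G π₁ π₂ n [] q ≠ 0 by
    obtain ⟨n, hn⟩ := h
    rw [reachProb, Ne, ENNReal.iSup_eq_zero]
    exact fun h => hn (h n)
  cases q with
  | p1 s B κ => exact (Live.exists_reachWithin_ne_zero hδ hπ₁ hq).1 B κ []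
  | p2 s B γ₁ κ => exact (Live.exists_reachWithin_ne_zero hδ hπ₁ hq).2 B γ₁ κ []
  | fin => exact ⟨0, by rw [reachWithin_fin]; exact one_ne_zero⟩
  | nat s B a γ₁ κ =>
    by_cases hF : ∃ s' ∈ (D.P s a).support, s' ∈ D.F
    · obtain ⟨s', hs', hF⟩ := hF
      refine ⟨0 + 1, reachWithin_succ_ne_zero (by simp) (m := .nature) (q' := .fin) ?_ ?_ ?_⟩
      · simp [moveLaw]
      · rw [hδ]
        exact fin_mem_support_natureLaw hs' hF
      · rw [reachWithin_fin]
        exact one_ne_zero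
    · push Not at hF
      obtain ⟨s', hs', hl | hl⟩ := hq
      · exact absurd hl (hF s' hs')
      obtain ⟨n, hn⟩ := (Live.exists_reachWithin_ne_zero (π₂ := π₂) hδ hπ₁ hl).2 B γ₁ κ
        ([] ++ [(.nat s B a γ₁ κ, .nature)])
      refine ⟨n + 1, reachWithin_succ_ne_zero (by simp) (m := .nature) ?_ ?_ hn⟩
      · simp [moveLaw]
      · rw [hδ]
        exact p2_mem_support_natureLaw hs' hF

/-! ### Subgames of the sensor-revealing game -/

/-- Subgames of the sensor-revealing game in which P1's enabled actions do not depend on the state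
and include the known ones. -/
structure IsSubgame (D : HiddenSensorGame S A Sen) (G : Arena S A D.Γ₁ D.Γ₂)
    (C : Set (A × D.Γ₁)) : Prop where
  δ_eq : G.δ = D.δ
  en₁_eq : ∀ q, G.en₁ q = C
  known_subset : D.knownActs ⊆ C
  subset : G.V ⊆ D.Q ∪ {.fin}
  en₂_nonempty : ∀ q, (G.en₂ q).Nonempty
  p2_closed : ∀ s B γ₁ κ γ₂, .p2 s B γ₁ κ ∈ G.V →
    .p1 s (B ∩ (D.Obs s γ₁ γ₂ : Set S)) κ ∈ G.V

theorem knownAtks_nonempty : D.knownAtks.Nonempty :=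
  let ⟨γ, h, h'⟩ := D.exists_known_attack
  ⟨⟨γ, h⟩, h'⟩

theorem knownActs_nonempty [Nonempty A] : D.knownActs.Nonempty :=
  let ⟨γ, h, h'⟩ := D.exists_known_query
  ⟨(Classical.arbitrary A, ⟨γ, h⟩), h'⟩

theorem nonempty_query : Nonempty D.Γ₁ :=
  let ⟨γ, h, _⟩ := D.exists_known_query
  ⟨⟨γ, h⟩⟩

theorem nonempty_attack : Nonempty D.Γ₂ :=
  let ⟨γ, h, _⟩ := D.exists_known_attack
  ⟨⟨γ, h⟩⟩

attribute [local instance] nonempty_query nonempty_attack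

theorem finite_Q [Finite S] [Finite A] [Finite Sen] : (D.Q ∪ {.fin}).Finite := by
  let C : Set ℤ := Set.Icc (-1) D.τ
  let f₁ : S × Set S × C → AState S A D.Γ₁ := fun x => .p1 x.1 x.2.1 x.2.2
  let f₂ : S × Set S × A × D.Γ₁ × C → AState S A D.Γ₁ :=
    fun x => .nat x.1 x.2.1 x.2.2.1 x.2.2.2.1 x.2.2.2.2
  let f₃ : S × Set S × D.Γ₁ × C → AState S A D.Γ₁ := fun x => .p2 x.1 x.2.1 x.2.2.1 x.2.2.2
  refine ((((Set.finite_range f₁).union (Set.finite_range f₂)).union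
    (Set.finite_range f₃)).subset ?_).union (Set.finite_singleton _)
  rintro (⟨s, B, κ⟩ | ⟨s, B, a, γ₁, κ⟩ | ⟨s, B, γ₁, κ⟩ | _) ⟨h, -⟩
  · exact Or.inl (Or.inl ⟨(s, B, ⟨κ, h⟩), rfl⟩)
  · exact Or.inl (Or.inr ⟨(s, B, a, γ₁, ⟨κ, h⟩), rfl⟩)
  · exact Or.inr ⟨(s, B, γ₁, ⟨κ, h⟩), rfl⟩
  · exact h.elim

namespace IsSubgame

variable {G : Arena S A D.Γ₁ D.Γ₂} {C : Set (A × D.Γ₁)}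

theorem consistent (hG : D.IsSubgame G C) (s : S) (B : Set S) (κ : ℤ) (h : .p1 s B κ ∈ G.V) :
    s ∈ B := by
  rcases hG.subset h with h | h
  · exact h.2
  · cases h

theorem isLocalAdversary (hG : D.IsSubgame G C) : IsLocalAdversary G G.en₂ (strategies₂ G) :=
  isLocalAdversary_strategies₂ hG.consistent (by rw [hG.δ_eq]; rfl)
    fun _ _ _ _ _ => hG.en₂_nonempty _

variable [Finite A] [Nonempty A] [Finite Sen]

/-- Against a P1 strategy that mixes all enabled actions, P2 cannot prevent a live state from
reaching the goal with positive probability; from a state that is not live, nothing reaches it. -/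
theorem mem_ASW₂_iff (hG : D.IsSubgame G C) {q : AState S A D.Γ₁} :
    q ∈ ASW₂ G ↔ q ∈ G.V ∧ ¬ D.LiveState q := by
  refine and_congr_right fun _ => ⟨fun ⟨π₂, _, h⟩ hq => ?_, fun hq => ?_⟩
  · obtain ⟨p, hp, -⟩ := exists_pmf_support_eq (PMF.pure (Classical.arbitrary (A × D.Γ₁))) C
    have hp := hp (knownActs_nonempty.mono hG.known_subset)
    refine hq.reachProb_ne_zero hG.δ_eq (π₁ := fun _ => p) (fun _ => hp ▸ hG.known_subset)
      (h _ ⟨fun _ _ _ _ => rfl, fun s B κ _ => ?_⟩)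
    rw [hp, hG.en₁_eq]
  · refine ⟨fun _ q => PMF.pure (hG.en₂_nonempty q).some, fun h s B γ₁ κ _ => ?_, fun π₁ _ => ?_⟩
    · rw [PMF.support_pure, Set.singleton_subset_iff]
      exact (hG.en₂_nonempty _).some_mem
    · by_contra h
      exact hq (liveState_of_reachProb_ne_zero hG.δ_eq h)

/-- Liveness excludes the clause for `ASW₂ G`, and the only other clause that discards an action
does so because it hands P1 the win. -/
theorem support_subset_ASW₁_of_notMem_SR₂ (hG : D.IsSubgame G C) {q : AState S A D.Γ₁}
    (hq : D.LiveState q) {γ₂ : D.Γ₂} (hγ : γ₂ ∈ G.en₂ q) (hn : γ₂ ∉ SR₂ G q) :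
    (G.δ q (.two γ₂)).support ⊆ ASW₁ G := by
  unfold SR₂ at hn
  split_ifs at hn with h1 h2
  · exact absurd hq (hG.mem_ASW₂_iff.1 h1).2
  · by_contra h
    exact hn ⟨hγ, h⟩
  · exact absurd hγ hn

variable [Finite S]

theorem isWinSet_ASW₁ (hG : D.IsSubgame G C) : IsWinSet G G.en₂ (ASW₁ G) :=
  isWinSet_winRegion hG.isLocalAdversary (finite_Q.subset hG.subset)

theorem subset_ASW₁ (hG : D.IsSubgame G C) {W : Set (AState S A D.Γ₁)}
    (hW : IsWinSet G G.en₂ W) : W ⊆ ASW₁ G :=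
  hW.subset_winRegion hG.isLocalAdversary (finite_Q.subset hG.subset)

/-- `PWin₂` quantifies over P1 strategies that are legal on all of `G.V`. The strategy mixing all
safe actions of the winning region is one, with the known action `m` as fallback where no action is
safe. -/
theorem notMem_PWin₂_of_mem_ASW₁ (hG : D.IsSubgame G C) {q : AState S A D.Γ₁}
    (hq : q ∈ ASW₁ G) : q ∉ PWin₂ G := by
  rintro ⟨-, π₂, hπ₂, h⟩
  obtain ⟨m, hm⟩ := knownActs_nonempty.mono hG.known_subset
  obtain ⟨π₁, hw, hπ₁⟩ := hG.isWinSet_ASW₁.exists_winsOn hG.isLocalAdversary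
    (finite_Q.subset hG.subset) (PMF.pure m)
  refine (h π₁ ⟨hw.beliefBased, fun s B κ hV => ?_⟩).ne (hw.wins π₂ hπ₂ q hq)
  rcases hπ₁ s B κ (hG.consistent s B κ hV) with h | h
  · exact h
  · rw [h, hG.en₁_eq, PMF.support_pure, Set.singleton_subset_iff]
    exact hm

/-- Adding a single P2 state whose successors all lie in the largest winning set gives a winning set
again. -/
theorem mem_ASW₁_of_forall (hG : D.IsSubgame G C) {s : S} {B : Set S} {γ₁ : D.Γ₁} {κ : ℤ}
    (hV : .p2 s B γ₁ κ ∈ G.V)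
    (h : ∀ γ₂ ∈ G.en₂ (.p2 s B γ₁ κ), (G.δ (.p2 s B γ₁ κ) (.two γ₂)).support ⊆ ASW₁ G) :
    .p2 s B γ₁ κ ∈ ASW₁ G := by
  have hX := hG.isWinSet_ASW₁
  refine hG.subset_ASW₁ (W := insert (.p2 s B γ₁ κ) (ASW₁ G)) ⟨?_, ?_, ?_, ?_, ?_⟩
    (Set.mem_insert _ _)
  · exact Set.insert_subset hV hX.subset
  · rintro s' B' κ' (h' | h') s'' hs''
    · cases h'
    · exact Or.inr (hX.beliefClosed s' B' κ' h' s'' hs'')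
  · rintro s' B' γ' κ' (h' | h') γ₂ hγ
    · rw [h'] at hγ ⊢
      exact (h γ₂ hγ).trans (Set.subset_insert _ _)
    · exact (hX.p2_closed _ _ _ _ h' γ₂ hγ).trans (Set.subset_insert _ _)
  · rintro s' B' a' γ' κ' (h' | h')
    · cases h'
    · exact (hX.nat_closed _ _ _ _ _ h').trans (Set.subset_insert _ _)
  · rintro q (rfl | hq)
    · refine .of_forall_exists fun γ₂ hγ => ?_
      obtain ⟨q', hq'⟩ := (G.δ (.p2 s B γ₁ κ) (.two γ₂)).support_nonempty
      exact ⟨q', hq', (hX.attr q' (h γ₂ hγ hq')).mono (Set.subset_insert _ _)⟩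
    · exact (hX.attr q hq).mono (Set.subset_insert _ _)

/-- If every enabled action were discarded at a state of `PWin₂ G`, all would lead into `ASW₁ G`,
and P1 would win at the state itself. Nonemptiness lets P2 have rationalizable strategies at all. -/
theorem SR₂_nonempty (hG : D.IsSubgame G C) {s : S} {B : Set S} {γ₁ : D.Γ₁} {κ : ℤ}
    (hV : .p2 s B γ₁ κ ∈ G.V) : (SR₂ G (.p2 s B γ₁ κ)).Nonempty := by
  unfold SR₂
  split_ifs with h1 h2
  · obtain ⟨γ₂, hγ⟩ := hG.en₂_nonempty (.p2 s B γ₁ κ)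
    refine ⟨γ₂, hγ, fun q' hq' => hG.mem_ASW₂_iff.2 ⟨?_, fun hl => ?_⟩⟩
    · rw [hG.δ_eq, δ, PMF.mem_support_pure_iff] at hq'
      rw [hq']
      exact hG.p2_closed _ _ _ _ _ hV
    · rw [hG.δ_eq] at hq'
      exact (hG.mem_ASW₂_iff.1 h1).2 (liveState_of_mem_support_δ hq' hl)
  · by_contra hne
    refine hG.notMem_PWin₂_of_mem_ASW₁ (hG.mem_ASW₁_of_forall hV fun γ₂ hγ => ?_) h2
    by_contra hsub
    exact hne ⟨γ₂, hγ, hsub⟩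
  · exact hG.en₂_nonempty _


end IsSubgame

end HiddenSensorGame


/-! ### Comparison of winning sets across games -/

/-- More actions for P1 and fewer for P2 can only help P1. The inclusion for P2 is needed on `W`
alone, since the induction never leaves `W`. -/
theorem IsWinSet.of_δ_eq {S A Qry Atk : Type*} {G G' : Arena S A Qry Atk}
    {E E' : AState S A Qry → Set Atk} {W : Set (AState S A Qry)} (hW : IsWinSet G E W)
    (hδ : G'.δ = G.δ) (hV : W ⊆ G'.V) (h₁ : ∀ q, G.en₁ q ⊆ G'.en₁ q)
    (hE : ∀ s B γ₁ κ, .p2 s B γ₁ κ ∈ W → E' (.p2 s B γ₁ κ) ⊆ E (.p2 s B γ₁ κ))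
    (hcons : ∀ s B κ, .p1 s B κ ∈ W → s ∈ B) :
    IsWinSet G' E' W where
  subset := hV
  beliefClosed := hW.beliefClosed
  p2_closed := fun s B γ₁ κ h γ₂ hγ => hδ ▸ hW.p2_closed s B γ₁ κ h γ₂ (hE _ _ _ _ h hγ)
  nat_closed := fun s B a γ₁ κ h => hδ ▸ hW.nat_closed s B a γ₁ κ h
  attr := fun q hq => by
    have ha := hW.attr q hq
    induction ha with
    | fin => exact .fin
    | @p1 s B κ m q' hm hq' _ ih =>
      exact .p1 (fun s' hs' => ⟨h₁ _ (hm s' hs').1, hδ ▸ (hm s' hs').2⟩) (hδ ▸ hq')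
        (ih ((hm s (hcons s B κ hq)).2 hq'))
    | nat hq' _ ih => exact .nat (hδ ▸ hq') (ih (hW.nat_closed _ _ _ _ _ hq hq'))
    | p2 g hg _ ih =>
      exact .p2 g (fun γ₂ hγ => hδ ▸ hg γ₂ (hE _ _ _ _ hq hγ)) fun γ₂ hγ =>
        ih γ₂ (hE _ _ _ _ hq hγ)
          (hW.p2_closed _ _ _ _ hq γ₂ (hE _ _ _ _ hq hγ) (hg γ₂ (hE _ _ _ _ hq hγ)))

namespace HiddenSensorGame

variable {S A Sen : Type*} {D : HiddenSensorGame S A Sen}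

attribute [local instance] nonempty_query nonempty_attack

/-! ### The counter and the derived games -/

theorem le_nextCounter (κ : ℤ) (γ₁ : D.Γ₁) : κ ≤ D.nextCounter κ γ₁ := by
  unfold nextCounter
  split_ifs <;> omega

theorem nextCounter_neg_one_of_notMem {γ₁ : D.Γ₁} (h : D.σ₀ ∉ (γ₁ : Set Sen)) :
    D.nextCounter (-1) γ₁ = -1 := by
  simp [nextCounter, h]

theorem nextCounter_neg_one_of_mem {γ₁ : D.Γ₁} (h : D.σ₀ ∈ (γ₁ : Set Sen)) :
    D.nextCounter (-1) γ₁ = 0 := by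
  have : (-1 : ℤ) ≠ D.τ := by omega
  simp [nextCounter, h, this]

theorem support_δ_p1 (s : S) (B : Set S) (κ : ℤ) (m : A × D.Γ₁) :
    (D.δ (.p1 s B κ) (.one m)).support =
      {.nat s (D.Post B m.1) m.1 m.2 (D.nextCounter κ m.2)} :=
  PMF.support_pure _

theorem support_δ_p2 (s : S) (B : Set S) (γ₁ : D.Γ₁) (κ : ℤ) (γ₂ : D.Γ₂) :
    (D.δ (.p2 s B γ₁ κ) (.two γ₂)).support = {.p1 s (B ∩ (D.Obs s γ₁ γ₂ : Set S)) κ} :=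
  PMF.support_pure _

theorem isSubgame_Gplus : D.IsSubgame D.Gplus Set.univ where
  δ_eq := rfl
  en₁_eq := fun _ => rfl
  known_subset := Set.subset_univ _
  subset := Set.union_subset_union_left _ (Set.sep_subset _ _)
  en₂_nonempty := fun q => by
    dsimp only [Gplus, H]
    split_ifs
    · exact knownAtks_nonempty
    · exact Set.univ_nonempty
  p2_closed := by
    rintro s B γ₁ κ γ₂ (⟨⟨h, hs⟩, h'⟩ | h)
    · exact Or.inl ⟨⟨h, hs, D.mem_obs s γ₁ γ₂⟩, h'⟩
    · cases h

theorem isSubgame_G2 : D.IsSubgame D.G2 D.knownActs where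
  δ_eq := rfl
  en₁_eq := fun _ => rfl
  known_subset := subset_rfl
  subset := Set.union_subset_union_left _ (Set.sep_subset _ _)
  en₂_nonempty := fun q => knownAtks_nonempty
  p2_closed := by
    rintro s B γ₁ κ γ₂ (⟨⟨h, hs⟩, h', _⟩ | h)
    · exact Or.inl ⟨⟨h, hs, D.mem_obs s γ₁ γ₂⟩, h', by rintro _ _ _ _ _ ⟨⟩⟩
    · cases h

variable (D) in
/-- The behaviorally subjectively rationalizable actions of P2. -/
noncomputable def bsrActs (q : AState S A D.Γ₁) : Set D.Γ₂ :=
  {γ₂ | (D.HasCounter (fun κ => κ = -1) q → γ₂ ∈ SR₂ D.G2 q) ∧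
    (D.HasCounter (fun κ => 0 ≤ κ) q → γ₂ ∈ SR₂ D.Gplus q)}

theorem bsrActs_p2_neg_one (s : S) (B : Set S) (γ₁ : D.Γ₁) :
    D.bsrActs (.p2 s B γ₁ (-1)) = SR₂ D.G2 (.p2 s B γ₁ (-1)) := by
  ext γ₂
  simp [bsrActs, HasCounter]

theorem bsrActs_p2_of_nonneg (s : S) (B : Set S) (γ₁ : D.Γ₁) {κ : ℤ} (hκ : 0 ≤ κ) :
    D.bsrActs (.p2 s B γ₁ κ) = SR₂ D.Gplus (.p2 s B γ₁ κ) := by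
  ext γ₂
  have : κ ≠ -1 := by omega
  simp [bsrActs, HasCounter, hκ, this]

theorem isBSR_iff {f : AState S A D.Γ₁ → PMF D.Γ₂} : D.IsBSR f ↔
    ∀ s B γ₁ κ, .p2 s B γ₁ κ ∈ D.H.V → (f (.p2 s B γ₁ κ)).support ⊆ D.bsrActs (.p2 s B γ₁ κ) := by
  refine forall₄_congr fun s B γ₁ κ => ⟨fun h hq γ₂ hγ => ?_, fun h hq => ⟨?_, ?_⟩⟩
  · have hq : .p2 s B γ₁ κ ∈ D.Q := by
      rcases hq with h | h
      · exact h
      · cases h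
    exact ⟨fun hκ => (h hq).1 hκ hγ, fun hκ => (h hq).2 hκ hγ⟩
  · exact fun hκ γ₂ hγ => (h (Or.inl hq) hγ).1 hκ
  · exact fun hκ γ₂ hγ => (h (Or.inl hq) hγ).2 hκ

theorem p2_mem_G2_V {s : S} {B : Set S} {γ₁ : D.Γ₁} (h : s ∈ B) :
    .p2 s B γ₁ (-1) ∈ D.G2.V :=
  Or.inl ⟨⟨⟨le_rfl, by omega⟩, h⟩, rfl, by rintro _ _ _ _ _ ⟨⟩⟩

theorem δ0_of_notMem {q : AState S A D.Γ₁} (hX : q ∉ ASW₁ D.G2) (hY : q ∉ ASW₂ D.G2)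
    (hq : ∀ s B a γ₁, q ≠ .nat s B a γ₁ 0) (m : Move A D.Γ₁ D.Γ₂) : D.δ0 q m = D.δ q m := by
  unfold δ0
  rw [if_neg hX, if_neg hY]
  cases q with
  | nat s B a γ₁ κ =>
    have hκ : κ ≠ 0 := by
      rintro rfl
      exact hq _ _ _ _ rfl
    simp only [if_neg hκ]
  | _ => rfl

theorem nat_zero_notMem_G2_V {s : S} {B : Set S} {a : A} {γ₁ : D.Γ₁} :
    .nat s B a γ₁ 0 ∉ D.G2.V := by
  rintro (⟨-, h, -⟩ | h)
  · exact absurd (show (0 : ℤ) = -1 from h) (by decide)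
  · cases h

theorem G0_en₁_of_mem {q : AState S A D.Γ₁} (hX : q ∈ ASW₁ D.G2) : D.G0.en₁ q = Set.univ :=
  if_pos (Or.inl hX)

theorem G0_en₁_of_notMem {q : AState S A D.Γ₁} (hX : q ∉ ASW₁ D.G2) (hY : q ∉ ASW₂ D.G2) :
    D.G0.en₁ q = SR₁ D.G2 q ∪ (D.knownActs)ᶜ :=
  if_neg fun h => h.elim hX hY

theorem G0_en₂_of_notMem {q : AState S A D.Γ₁} (hX : q ∉ ASW₁ D.G2) (hY : q ∉ ASW₂ D.G2) :
    D.G0.en₂ q = SR₂ D.G2 q :=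
  if_neg fun h => h.elim hX hY

theorem G0_V_subset : D.G0.V ⊆ D.Q ∪ {.fin} :=
  Set.union_subset_union_left _ (Set.sep_subset _ _)

/-- `Adv` is nonempty, so winning entails that some pair of strategies reaches the goal. -/
theorem liveState_of_mem_winRegion {G : Arena S A D.Γ₁ D.Γ₂} (hδ : G.δ = D.δ)
    {E : AState S A D.Γ₁ → Set D.Γ₂} {Adv : Set (Strategy₂ S A D.Γ₁ D.Γ₂)}
    (hA : IsLocalAdversary G E Adv) {q : AState S A D.Γ₁} (hq : q ∈ winRegion G Adv) :
    D.LiveState q := by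
  classical
  obtain ⟨π₁, W, hw, hq⟩ := hq
  have : (fun _ q => PMF.pure (if h : (E q).Nonempty then h.some else Classical.arbitrary _)) ∈
      Adv := by
    refine hA.memoryless_mem _ fun s B γ₁ κ hV => ?_
    have := hA.nonempty s B γ₁ κ hV
    rw [dif_pos this, PMF.support_pure, Set.singleton_subset_iff]
    exact this.some_mem
  exact liveState_of_reachProb_ne_zero hδ ((hw.wins _ this q hq).trans_ne one_ne_zero)

theorem δ0_of_mem_ASW₁ {q : AState S A D.Γ₁} (hq : q ∈ ASW₁ D.G2) (m : Move A D.Γ₁ D.Γ₂) :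
    D.δ0 q m = PMF.pure .fin := by
  unfold δ0
  rw [if_pos hq]

theorem liveState_of_mem_ASW₁_G2 {q : AState S A D.Γ₁} (hq : q ∈ ASW₁ D.G2) : D.LiveState q :=
  liveState_of_mem_winRegion rfl isSubgame_G2.isLocalAdversary hq

section Finite

variable [Finite A] [Nonempty A] [Finite Sen]

theorem notMem_ASW₂_G2_of_liveState {q : AState S A D.Γ₁} (h : D.LiveState q) :
    q ∉ ASW₂ D.G2 := fun h' => (isSubgame_G2.mem_ASW₂_iff.1 h').2 h

variable [Finite S]

theorem isLocalAdversary_H :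
    IsLocalAdversary D.H D.bsrActs {π₂ | ∃ f, D.IsBSR f ∧ π₂ = fun _ q => f q} where
  consistent := by
    rintro s B κ (h | h)
    · exact h.2
    · cases h
  sink := rfl
  nonempty := by
    rintro s B γ₁ κ (⟨⟨h1, h2⟩, hs⟩ | h)
    · rcases h1.eq_or_lt with rfl | h1
      · rw [bsrActs_p2_neg_one]
        exact isSubgame_G2.SR₂_nonempty (p2_mem_G2_V hs)
      · have h0 : 0 ≤ κ := by omega
        rw [bsrActs_p2_of_nonneg _ _ _ h0]
        exact isSubgame_Gplus.SR₂_nonempty (Or.inl ⟨⟨⟨h1.le, h2⟩, hs⟩, h0⟩)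
    · cases h
  support_subset := by
    rintro _ ⟨f, hf, rfl⟩ _
    exact isBSR_iff.1 hf
  memoryless_mem := fun f hf => ⟨f, isBSR_iff.2 hf, rfl⟩

theorem isWinSet_DASW₁ : IsWinSet D.H D.bsrActs D.DASW₁ :=
  isWinSet_winRegion isLocalAdversary_H finite_Q

theorem liveState_of_mem_DASW₁ {q : AState S A D.Γ₁} (hq : q ∈ D.DASW₁) : D.LiveState q :=
  liveState_of_mem_winRegion rfl isLocalAdversary_H hq

/-! ### The delay-attack game -/

theorem isWinSet_H_ASW₁_Gplus : IsWinSet D.H D.bsrActs (ASW₁ D.Gplus) := by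
  have hZ := (isSubgame_Gplus (D := D)).isWinSet_ASW₁
  refine hZ.of_δ_eq rfl (hZ.subset.trans isSubgame_Gplus.subset) (fun _ => subset_rfl) ?_
    fun s B κ h => isSubgame_Gplus.consistent s B κ (hZ.subset h)
  intro s B γ₁ κ h
  rcases hZ.subset h with ⟨-, h⟩ | h
  · rw [bsrActs_p2_of_nonneg _ _ _ h]
    exact SR₂_subset _
  · cases h

theorem isWinSet_H_ASW₁_G2 : IsWinSet D.H D.bsrActs (ASW₁ D.G2) := by
  have hX := (isSubgame_G2 (D := D)).isWinSet_ASW₁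
  refine hX.of_δ_eq rfl (hX.subset.trans isSubgame_G2.subset) (fun _ => Set.subset_univ _) ?_
    fun s B κ h => isSubgame_G2.consistent s B κ (hX.subset h)
  intro s B γ₁ κ h
  rcases hX.subset h with ⟨-, h, -⟩ | h
  · obtain rfl : κ = -1 := h
    rw [bsrActs_p2_neg_one]
    exact SR₂_subset _
  · cases h

/-- The counter never decreases, so the late part of the deceptive region is closed under
rationalizable play. Any other attack of P2 leads into `ASW₁ D.Gplus`; hence the union of the two is
a winning set against all attacks. -/
theorem mem_ASW₁_Gplus_of_mem_DASW₁ {q : AState S A D.Γ₁} (hq : q ∈ D.DASW₁)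
    (hκ : D.HasCounter (fun κ => 0 ≤ κ) q ∨ q = .fin) : q ∈ ASW₁ D.Gplus := by
  have hW := isWinSet_DASW₁ (D := D)
  have hZ := (isSubgame_Gplus (D := D)).isWinSet_ASW₁
  set W' := {q ∈ D.DASW₁ | D.HasCounter (fun κ => 0 ≤ κ) q ∨ q = .fin} ∪ ASW₁ D.Gplus
  have nat_late : ∀ s B a γ₁ κ q', 0 ≤ κ → .nat s B a γ₁ κ ∈ D.DASW₁ →
      q' ∈ (D.δ (.nat s B a γ₁ κ) .nature).support →
      q' ∈ D.DASW₁ ∧ (D.HasCounter (fun κ => 0 ≤ κ) q' ∨ q' = .fin) := by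
    intro s B a γ₁ κ q' hκ hq hq'
    refine ⟨hW.nat_closed _ _ _ _ _ hq hq', ?_⟩
    rcases of_mem_support_natureLaw hq' with ⟨h, -⟩ | ⟨s', -, rfl⟩
    · exact Or.inr h
    · exact Or.inl hκ
  have p2_late : ∀ s B γ₁ κ γ₂, 0 ≤ κ → .p2 s B γ₁ κ ∈ D.DASW₁ →
      γ₂ ∈ D.Gplus.en₂ (.p2 s B γ₁ κ) →
      (γ₂ ∈ D.bsrActs (.p2 s B γ₁ κ) ∧ .p1 s (B ∩ (D.Obs s γ₁ γ₂ : Set S)) κ ∈ D.DASW₁) ∨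
        .p1 s (B ∩ (D.Obs s γ₁ γ₂ : Set S)) κ ∈ ASW₁ D.Gplus := by
    intro s B γ₁ κ γ₂ hκ hq hγ
    by_cases h : γ₂ ∈ D.bsrActs (.p2 s B γ₁ κ)
    · refine Or.inl ⟨h, hW.p2_closed _ _ _ _ hq γ₂ h ?_⟩
      exact (support_δ_p2 s B γ₁ κ γ₂).ge rfl
    · rw [bsrActs_p2_of_nonneg _ _ _ hκ] at h
      exact Or.inr (isSubgame_Gplus.support_subset_ASW₁_of_notMem_SR₂
        (liveState_of_mem_DASW₁ hq) hγ h ((support_δ_p2 s B γ₁ κ γ₂).ge rfl))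
  refine isSubgame_Gplus.subset_ASW₁ (W := W') ⟨?_, ?_, ?_, ?_, ?_⟩ (Or.inl ⟨hq, hκ⟩)
  · refine Set.union_subset ?_ hZ.subset
    rintro q ⟨hq, hκ | rfl⟩
    · rcases hW.subset hq with hQ | rfl
      · exact Or.inl ⟨hQ, hκ⟩
      · exact Or.inr rfl
    · exact Or.inr rfl
  · rintro s B κ (⟨h, hκ | hf⟩ | h) s' hs'
    · exact Or.inl ⟨hW.beliefClosed s B κ h s' hs', Or.inl hκ⟩
    · cases hf
    · exact Or.inr (hZ.beliefClosed s B κ h s' hs')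
  · rintro s B γ₁ κ (⟨h, hκ | hf⟩ | h) γ₂ hγ
    · refine (support_δ_p2 s B γ₁ κ γ₂).trans_subset (Set.singleton_subset_iff.2 ?_)
      exact (p2_late s B γ₁ κ γ₂ hκ h hγ).imp (fun h => ⟨h.2, Or.inl hκ⟩) id
    · cases hf
    · exact (hZ.p2_closed _ _ _ _ h γ₂ hγ).trans Set.subset_union_right
  · rintro s B a γ₁ κ (⟨h, hκ | hf⟩ | h)
    · exact fun q' hq' => Or.inl (nat_late s B a γ₁ κ q' hκ h hq')
    · cases hf
    · exact (hZ.nat_closed _ _ _ _ _ h).trans Set.subset_union_right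
  · rintro q (⟨hq, hκ⟩ | hq)
    · have ha := hW.attr q hq
      induction ha with
      | fin => exact .fin
      | @p1 s B κ m q' hm hq' _ ih =>
        have hκ : 0 ≤ κ := hκ.resolve_right (by rintro ⟨⟩)
        have hκ' := hκ.trans (D.le_nextCounter κ m.2)
        have hs : s ∈ B := isLocalAdversary_H.consistent s B κ (hW.subset hq)
        have hq'W := (hm s hs).2 hq'
        rw [show D.H.δ = D.δ from rfl, support_δ_p1] at hq'
        subst hq'
        refine .p1 (m := m) (fun s' hs' => ⟨trivial, ?_⟩) ((support_δ_p1 s B κ m).ge rfl)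
          (ih hq'W (Or.inl hκ'))
        refine (support_δ_p1 s' B κ m).trans_subset (Set.singleton_subset_iff.2 ?_)
        exact Or.inl ⟨(hm s' hs').2 ((support_δ_p1 s' B κ m).ge rfl), Or.inl hκ'⟩
      | @nat s B a γ₁ κ q' hq' _ ih =>
        have hκ : 0 ≤ κ := hκ.resolve_right (by rintro ⟨⟩)
        have := nat_late s B a γ₁ κ q' hκ hq hq'
        exact .nat hq' (ih this.1 this.2)
      | @p2 s B γ₁ κ g hg _ ih =>
        have hκ : 0 ≤ κ := hκ.resolve_right (by rintro ⟨⟩)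
        refine .of_forall_exists fun γ₂ hγ => ⟨_, (support_δ_p2 s B γ₁ κ γ₂).ge rfl, ?_⟩
        rcases p2_late s B γ₁ κ γ₂ hκ hq hγ with ⟨h, h'⟩ | h
        · have hgγ : g γ₂ = _ := (support_δ_p2 s B γ₁ κ γ₂).le (hg γ₂ h)
          have := ih γ₂ h
          rw [hgγ] at this
          exact this h' (Or.inl hκ)
        · exact (hZ.attr _ h).mono Set.subset_union_right
    · exact (hZ.attr q hq).mono Set.subset_union_right

/-! ### The initial game -/

theorem fin_mem_ASW₁_G2 : .fin ∈ ASW₁ D.G2 := by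
  refine isSubgame_G2.subset_ASW₁ (W := {.fin}) ⟨?_, ?_, ?_, ?_, ?_⟩ rfl
  · exact Set.subset_union_right
  · rintro _ _ _ ⟨⟩
  · rintro _ _ _ _ ⟨⟩
  · rintro _ _ _ _ _ ⟨⟩
  · rintro _ rfl
    exact .fin

theorem δ0_of_mem_ASW₂ {q : AState S A D.Γ₁} (hq : q ∈ ASW₂ D.G2) (m : Move A D.Γ₁ D.Γ₂) :
    D.δ0 q m = PMF.pure q := by
  unfold δ0
  rw [if_neg fun h => notMem_ASW₂_G2_of_liveState (liveState_of_mem_ASW₁_G2 h) hq, if_pos hq]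

open Classical in
theorem δ0_nat_zero (s : S) (B : Set S) (a : A) (γ₁ : D.Γ₁) (m : Move A D.Γ₁ D.Γ₂) :
    D.δ0 (.nat s B a γ₁ 0) m = if .nat s B a γ₁ 0 ∈ ASW₁ D.Gplus then PMF.pure .fin
      else PMF.pure (.nat s B a γ₁ 0) := by
  unfold δ0
  rw [if_neg fun h => nat_zero_notMem_G2_V (isSubgame_G2.isWinSet_ASW₁.subset h),
    if_neg fun h => nat_zero_notMem_G2_V h.1]
  simp only [if_true]

theorem isLocalAdversary_G0 : IsLocalAdversary D.G0 D.G0.en₂ (strategies₂ D.G0) := by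
  refine isLocalAdversary_strategies₂ ?_ (δ0_of_mem_ASW₁ fin_mem_ASW₁_G2 _) ?_
  · rintro s B κ (h | h)
    · exact h.1.2
    · cases h
  · rintro s B γ₁ κ (⟨⟨-, hs⟩, h | ⟨_, _, _, _, ⟨⟩⟩⟩ | h)
    · obtain rfl : κ = -1 := h
      by_cases hXY : .p2 s B γ₁ (-1) ∈ ASW₁ D.G2 ∪ ASW₂ D.G2
      · rw [show D.G0.en₂ _ = _ from if_pos hXY]
        exact knownAtks_nonempty
      · rw [show D.G0.en₂ _ = _ from if_neg hXY]
        exact isSubgame_G2.SR₂_nonempty (p2_mem_G2_V hs)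
    · cases h

theorem isWinSet_ASW₁_G0 : IsWinSet D.G0 D.G0.en₂ (ASW₁ D.G0) :=
  isWinSet_winRegion isLocalAdversary_G0 (finite_Q.subset G0_V_subset)

theorem attr_G0_of_mem_ASW₁_G2 {W : Set (AState S A D.Γ₁)} (hW : .fin ∈ W)
    {q : AState S A D.Γ₁} (hq : q ∈ ASW₁ D.G2) : Attr D.G0 D.G0.en₂ W q := by
  have hsupp : ∀ q ∈ ASW₁ D.G2, ∀ m, (D.G0.δ q m).support = {.fin} := fun q hq m => by
    rw [show D.G0.δ = D.δ0 from rfl, δ0_of_mem_ASW₁ hq, PMF.support_pure]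
  cases q with
  | fin => exact .fin
  | nat s B a γ₁ κ => exact .nat ((hsupp _ hq _).ge rfl) .fin
  | p2 s B γ₁ κ => exact .of_forall_exists fun γ₂ _ => ⟨.fin, (hsupp _ hq _).ge rfl, .fin⟩
  | p1 s B κ =>
    -- Any action will do: all are enabled here and all lead to the final state, from every state of
    -- the belief.
    refine .p1 (m := Classical.arbitrary _) (fun s' hs' => ?_) ((hsupp _ hq _).ge rfl) .fin
    have h := isSubgame_G2.isWinSet_ASW₁.beliefClosed s B κ hq s' hs'
    refine ⟨?_, (hsupp _ h _).trans_subset (Set.singleton_subset_iff.2 hW)⟩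
    rw [G0_en₁_of_mem h]
    trivial

/-- The winning set consists of the deceptive states with counter `-1`, the deceptive handover
states of nature with counter `0`, and `ASW₁ D.G2`. The handover states lead to the final state
because they are already known to be won in the delay-attack game. -/
theorem mem_ASW₁_G0_of_mem_DASW₁ {q : AState S A D.Γ₁} (hq : q ∈ D.DASW₁)
    (hκ : D.HasCounter (fun κ => κ = -1) q) : q ∈ ASW₁ D.G0 := by
  have hW := isWinSet_DASW₁ (D := D)
  have hX := (isSubgame_G2 (D := D)).isWinSet_ASW₁
  set C : AState S A D.Γ₁ → Prop := fun q =>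
    D.HasCounter (fun κ => κ = -1) q ∨ ∃ s B a γ₁, q = .nat s B a γ₁ 0
  set W' := {q ∈ D.DASW₁ | C q} ∪ ASW₁ D.G2
  have hfin : .fin ∈ W' := Or.inr fin_mem_ASW₁_G2
  have hY : ∀ q ∈ D.DASW₁, q ∉ ASW₂ D.G2 := fun q hq =>
    notMem_ASW₂_G2_of_liveState (liveState_of_mem_DASW₁ hq)
  have hX' : ∀ q ∈ ASW₁ D.G2, ∀ m, (D.G0.δ q m).support ⊆ W' := fun q hq m => by
    rw [show D.G0.δ = D.δ0 from rfl, δ0_of_mem_ASW₁ hq, PMF.support_pure]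
    exact Set.singleton_subset_iff.2 hfin
  have hδ : ∀ q ∈ D.DASW₁, q ∉ ASW₁ D.G2 → (∀ s B a γ₁, q ≠ .nat s B a γ₁ 0) →
      ∀ m, D.G0.δ q m = D.δ q m := fun q hq h h0 m => δ0_of_notMem h (hY q hq) h0 m
  have nat_zero : ∀ s B a γ₁, .nat s B a γ₁ 0 ∈ D.DASW₁ →
      D.G0.δ (.nat s B a γ₁ 0) .nature = PMF.pure .fin := fun s B a γ₁ h =>
    (δ0_nat_zero s B a γ₁ _).trans (if_pos (mem_ASW₁_Gplus_of_mem_DASW₁ h (Or.inl le_rfl)))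
  have nat_early : ∀ s B a γ₁, .nat s B a γ₁ (-1) ∈ D.DASW₁ →
      ∀ q' ∈ (D.δ (.nat s B a γ₁ (-1)) .nature).support, q' ∈ D.DASW₁ ∧ (C q' ∨ q' = .fin) := by
    intro s B a γ₁ h q' hq'
    refine ⟨hW.nat_closed _ _ _ _ _ h hq', ?_⟩
    rcases of_mem_support_natureLaw hq' with ⟨h, -⟩ | ⟨s', -, rfl⟩
    · exact Or.inr h
    · exact Or.inl (Or.inl rfl)
  have next_class : ∀ s B (m : A × D.Γ₁), C (.nat s B m.1 m.2 (D.nextCounter (-1) m.2)) := by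
    intro s B m
    by_cases hm : D.σ₀ ∈ (m.2 : Set Sen)
    · rw [nextCounter_neg_one_of_mem hm]
      exact Or.inr ⟨_, _, _, _, rfl⟩
    · rw [nextCounter_neg_one_of_notMem hm]
      exact Or.inl rfl
  refine IsWinSet.subset_winRegion (W := W') isLocalAdversary_G0
    (finite_Q.subset G0_V_subset) ⟨?_, ?_, ?_, ?_, ?_⟩ (Or.inl ⟨hq, Or.inl hκ⟩)
  · rintro q (⟨hq, hc⟩ | hq)
    · exact (hW.subset hq).imp_left fun h => ⟨h, hc⟩
    · exact (hX.subset hq).imp_left fun h => ⟨h.1, Or.inl h.2.1⟩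
  · rintro s B κ (⟨h, hκ | ⟨_, _, _, _, ⟨⟩⟩⟩ | h) s' hs'
    · exact Or.inl ⟨hW.beliefClosed s B κ h s' hs', Or.inl hκ⟩
    · exact Or.inr (hX.beliefClosed s B κ h s' hs')
  · intro s B γ₁ κ h γ₂ hγ
    by_cases hx : .p2 s B γ₁ κ ∈ ASW₁ D.G2
    · exact hX' _ hx _
    obtain ⟨h, hκ | ⟨_, _, _, _, ⟨⟩⟩⟩ := h.resolve_right hx
    obtain rfl : κ = -1 := hκ
    rw [G0_en₂_of_notMem hx (hY _ h), ← bsrActs_p2_neg_one] at hγ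
    rw [hδ _ h hx (by rintro _ _ _ _ ⟨⟩)]
    intro q' hq'
    refine Or.inl ⟨hW.p2_closed _ _ _ _ h γ₂ hγ hq', ?_⟩
    rw [support_δ_p2] at hq'
    obtain rfl := hq'
    exact Or.inl rfl
  · intro s B a γ₁ κ h
    by_cases hx : .nat s B a γ₁ κ ∈ ASW₁ D.G2
    · exact hX' _ hx _
    obtain ⟨h, hκ | ⟨_, _, _, _, ⟨⟩⟩⟩ := h.resolve_right hx
    · obtain rfl : κ = -1 := hκ
      rw [hδ _ h hx (by rintro _ _ _ _ ⟨⟩)]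
      intro q' hq'
      obtain ⟨h1, h2 | rfl⟩ := nat_early _ _ _ _ h q' hq'
      · exact Or.inl ⟨h1, h2⟩
      · exact hfin
    · rw [nat_zero _ _ _ _ h, PMF.support_pure]
      exact Set.singleton_subset_iff.2 hfin
  · intro q hqW
    by_cases hx : q ∈ ASW₁ D.G2
    · exact attr_G0_of_mem_ASW₁_G2 hfin hx
    obtain ⟨hq, hc⟩ := hqW.resolve_right hx
    -- Otherwise these would become premises of the induction hypotheses.
    clear hx hqW
    have ha := hW.attr q hq
    induction ha with
    | fin => exact .fin
    | @p1 s B κ m q' hm hq' _ ih =>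
      by_cases hx : .p1 s B κ ∈ ASW₁ D.G2
      · exact attr_G0_of_mem_ASW₁_G2 hfin hx
      obtain hκ | ⟨_, _, _, _, ⟨⟩⟩ := hc
      obtain rfl : κ = -1 := hκ
      have hs : s ∈ B := isLocalAdversary_H.consistent s B _ (hW.subset hq)
      have hq'W := (hm s hs).2 hq'
      rw [show D.H.δ = D.δ from rfl, support_δ_p1] at hq'
      subst hq'
      refine .p1 (m := m) (fun s' hs' => ?_) ?_ (ih hq'W (next_class _ _ _))
      · have h := hW.beliefClosed s B _ hq s' hs'
        -- By belief-closedness, the states of one belief are all inside or all outside `ASW₁ D.G2`.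
        have hx' : .p1 s' B (-1) ∉ ASW₁ D.G2 := fun h' => hx (hX.beliefClosed s' B _ h' s hs)
        have hsucc := (hm s' hs').2 ((support_δ_p1 s' B _ m).ge rfl)
        constructor
        · rw [G0_en₁_of_notMem hx' (hY _ h)]
          by_cases hk : m ∈ D.knownActs
          · left
            -- A safe known action is rationalizable for P1: its successor is in the deceptive
            -- region, hence live, hence outside `ASW₂ D.G2`.
            rw [SR₁, if_neg hx']
            split_ifs
            · refine ⟨hk, fun hsub => hY _ hsucc (hsub ((support_δ_p1 s' B _ m).ge rfl))⟩
            · exact hk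
          · exact Or.inr hk
        · rw [hδ _ h hx' (by rintro _ _ _ _ ⟨⟩), support_δ_p1]
          exact Set.singleton_subset_iff.2 (Or.inl ⟨hsucc, next_class _ _ _⟩)
      · rw [hδ _ hq hx (by rintro _ _ _ _ ⟨⟩), support_δ_p1]
        rfl
    | @nat s B a γ₁ κ q' hq' _ ih =>
      by_cases hx : .nat s B a γ₁ κ ∈ ASW₁ D.G2
      · exact attr_G0_of_mem_ASW₁_G2 hfin hx
      obtain hκ | ⟨_, _, _, _, ⟨⟩⟩ := hc
      · obtain rfl : κ = -1 := hκ
        refine .nat (q' := q') ?_ ?_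
        · rw [hδ _ hq hx (by rintro _ _ _ _ ⟨⟩)]
          exact hq'
        · obtain ⟨h1, h2 | rfl⟩ := nat_early _ _ _ _ hq q' hq'
          · exact ih h1 h2
          · exact .fin
      · refine .nat (q' := .fin) ?_ .fin
        rw [nat_zero _ _ _ _ hq, PMF.support_pure]
        rfl
    | @p2 s B γ₁ κ g hg _ ih =>
      by_cases hx : .p2 s B γ₁ κ ∈ ASW₁ D.G2
      · exact attr_G0_of_mem_ASW₁_G2 hfin hx
      obtain hκ | ⟨_, _, _, _, ⟨⟩⟩ := hc
      obtain rfl : κ = -1 := hκ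
      refine .of_forall_exists fun γ₂ hγ => ⟨g γ₂, ?_⟩
      rw [G0_en₂_of_notMem hx (hY _ hq), ← bsrActs_p2_neg_one] at hγ
      rw [hδ _ hq hx (by rintro _ _ _ _ ⟨⟩)]
      refine ⟨hg γ₂ hγ, ih γ₂ hγ (hW.p2_closed _ _ _ _ hq γ₂ hγ (hg γ₂ hγ)) ?_⟩
      rw [show g γ₂ = _ from (support_δ_p2 s B γ₁ _ γ₂).le (hg γ₂ hγ)]
      exact Or.inl rfl

/-! ### From the initial game back to the sensor-revealing game -/

/-- The excluded states are absorbing in the initial game, so no path to the final state passes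
through them. -/
theorem notMem_ASW₂_of_attr_G0 {W : Set (AState S A D.Γ₁)}
    (hW : IsWinSet D.G0 D.G0.en₂ W) {q : AState S A D.Γ₁} (ha : Attr D.G0 D.G0.en₂ W q)
    (hq : q ∈ W) :
    q ∉ ASW₂ D.G2 ∧ ∀ s B a γ₁, q = .nat s B a γ₁ 0 → q ∈ ASW₁ D.Gplus := by
  have key : ∀ q q' m, q' ∈ (D.G0.δ q m).support → q' ∉ ASW₂ D.G2 → q ∉ ASW₂ D.G2 := by
    intro q q' m hq' h hq
    rw [show D.G0.δ = D.δ0 from rfl, δ0_of_mem_ASW₂ hq, PMF.mem_support_pure_iff] at hq'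
    exact h (hq' ▸ hq)
  induction ha with
  | fin => exact ⟨notMem_ASW₂_G2_of_liveState trivial, by rintro _ _ _ _ ⟨⟩⟩
  | @p1 s B κ m q' hm hq' _ ih =>
    have hs := isLocalAdversary_G0.consistent _ _ _ (hW.subset hq)
    exact ⟨key _ _ _ hq' (ih ((hm s hs).2 hq')).1, by rintro _ _ _ _ ⟨⟩⟩
  | @nat s B a γ₁ κ q' hq' _ ih =>
    have ih := ih (hW.nat_closed _ _ _ _ _ hq hq')
    refine ⟨key _ _ _ hq' ih.1, ?_⟩
    rintro _ _ _ _ ⟨⟩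
    -- A handover state outside `ASW₁ D.Gplus` has itself as only successor, so the induction
    -- hypothesis speaks of this very state.
    by_contra h
    rw [show D.G0.δ = D.δ0 from rfl, δ0_nat_zero, if_neg h, PMF.mem_support_pure_iff] at hq'
    subst hq'
    exact h (ih.2 _ _ _ _ rfl)
  | @p2 s B γ₁ κ g hg _ ih =>
    obtain ⟨γ₂, hγ⟩ := isLocalAdversary_G0.nonempty _ _ _ _ (hW.subset hq)
    exact ⟨key _ _ _ (hg γ₂ hγ)
      (ih γ₂ hγ (hW.p2_closed _ _ _ _ hq γ₂ hγ (hg γ₂ hγ))).1, by rintro _ _ _ _ ⟨⟩⟩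

/-- The initial game only shortcuts wins: outside `ASW₁ D.G2` and `ASW₁ D.Gplus`, its winning region
has the transitions of `D.H` and the rationalizable attacks. Adding these two regions, which are
winning sets of `D.H` themselves, replaces the shortcuts by genuine wins. -/
theorem ASW₁_G0_subset_DASW₁ : ASW₁ D.G0 ⊆ D.DASW₁ := by
  have hU := isWinSet_ASW₁_G0 (D := D)
  have hX := isWinSet_H_ASW₁_G2 (D := D)
  have hZ := isWinSet_H_ASW₁_Gplus (D := D)
  set W' := ASW₁ D.G0 ∪ (ASW₁ D.G2 ∪ ASW₁ D.Gplus)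
  have hXW : ASW₁ D.G2 ⊆ W' := Set.subset_union_left.trans Set.subset_union_right
  have hZW : ASW₁ D.Gplus ⊆ W' := Set.subset_union_right.trans Set.subset_union_right
  have hY : ∀ q ∈ ASW₁ D.G0, q ∉ ASW₂ D.G2 := fun q hq =>
    (notMem_ASW₂_of_attr_G0 hU (hU.attr q hq) hq).1
  have hnat : ∀ s B a γ₁, .nat s B a γ₁ 0 ∈ ASW₁ D.G0 → .nat s B a γ₁ 0 ∈ ASW₁ D.Gplus :=
    fun s B a γ₁ hq => (notMem_ASW₂_of_attr_G0 hU (hU.attr _ hq) hq).2 _ _ _ _ rfl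
  have hδ : ∀ q ∈ ASW₁ D.G0, q ∉ ASW₁ D.G2 → q ∉ ASW₁ D.Gplus →
      ∀ m, D.G0.δ q m = D.H.δ q m := fun q hq hx hz m => by
    refine δ0_of_notMem hx (hY q hq) ?_ m
    rintro s B a γ₁ rfl
    exact hz (hnat _ _ _ _ hq)
  have hE : ∀ s B γ₁ κ, .p2 s B γ₁ κ ∈ ASW₁ D.G0 → .p2 s B γ₁ κ ∉ ASW₁ D.G2 →
      D.bsrActs (.p2 s B γ₁ κ) = D.G0.en₂ (.p2 s B γ₁ κ) := by
    intro s B γ₁ κ hq hx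
    rw [G0_en₂_of_notMem hx (hY _ hq)]
    rcases hU.subset hq with ⟨-, h | ⟨_, _, _, _, ⟨⟩⟩⟩ | h
    · obtain rfl : κ = -1 := h
      exact bsrActs_p2_neg_one _ _ _
    · cases h
  refine Set.Subset.trans Set.subset_union_left (IsWinSet.subset_winRegion (W := W')
    isLocalAdversary_H finite_Q ⟨?_, ?_, ?_, ?_, ?_⟩)
  · exact Set.union_subset (hU.subset.trans G0_V_subset) (Set.union_subset hX.subset hZ.subset)
  · rintro s B κ (h | h | h) s' hs'
    · exact Or.inl (hU.beliefClosed s B κ h s' hs')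
    · exact hXW (hX.beliefClosed s B κ h s' hs')
    · exact hZW (hZ.beliefClosed s B κ h s' hs')
  · intro s B γ₁ κ hq γ₂ hγ
    by_cases hx : .p2 s B γ₁ κ ∈ ASW₁ D.G2
    · exact (hX.p2_closed _ _ _ _ hx γ₂ hγ).trans hXW
    by_cases hz : .p2 s B γ₁ κ ∈ ASW₁ D.Gplus
    · exact (hZ.p2_closed _ _ _ _ hz γ₂ hγ).trans hZW
    have hq := hq.resolve_right fun h => h.elim hx hz
    rw [hE _ _ _ _ hq hx] at hγ
    rw [← hδ _ hq hx hz]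
    exact (hU.p2_closed _ _ _ _ hq γ₂ hγ).trans Set.subset_union_left
  · intro s B a γ₁ κ hq
    by_cases hx : .nat s B a γ₁ κ ∈ ASW₁ D.G2
    · exact (hX.nat_closed _ _ _ _ _ hx).trans hXW
    by_cases hz : .nat s B a γ₁ κ ∈ ASW₁ D.Gplus
    · exact (hZ.nat_closed _ _ _ _ _ hz).trans hZW
    have hq := hq.resolve_right fun h => h.elim hx hz
    rw [← hδ _ hq hx hz]
    exact (hU.nat_closed _ _ _ _ _ hq).trans Set.subset_union_left
  · rintro q (hq | hq | hq)
    · have hother : ∀ q, ¬ (q ∉ ASW₁ D.G2 ∧ q ∉ ASW₁ D.Gplus) → Attr D.H D.bsrActs W' q := by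
        intro q h
        by_cases hx : q ∈ ASW₁ D.G2
        · exact (hX.attr q hx).mono hXW
        · exact (hZ.attr q (not_not.1 fun hz => h ⟨hx, hz⟩)).mono hZW
      have ha := hU.attr q hq
      induction ha with
      | fin => exact .fin
      | @p1 s B κ m q' hm hq' _ ih =>
        by_cases hxz : .p1 s B κ ∉ ASW₁ D.G2 ∧ .p1 s B κ ∉ ASW₁ D.Gplus
        swap
        · exact hother _ hxz
        have hs := isLocalAdversary_G0.consistent _ _ _ (hU.subset hq)
        refine .p1 (m := m) (fun s' hs' => ⟨trivial, ?_⟩) (hδ _ hq hxz.1 hxz.2 (.one m) ▸ hq')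
          (ih ((hm s hs).2 hq'))
        rw [← hδ _ (hU.beliefClosed _ _ _ hq s' hs')
          (fun h => hxz.1 (hX.beliefClosed _ _ _ h s hs))
          (fun h => hxz.2 (hZ.beliefClosed _ _ _ h s hs))]
        exact (hm s' hs').2.trans Set.subset_union_left
      | @nat s B a γ₁ κ q' hq' _ ih =>
        by_cases hxz : .nat s B a γ₁ κ ∉ ASW₁ D.G2 ∧ .nat s B a γ₁ κ ∉ ASW₁ D.Gplus
        swap
        · exact hother _ hxz
        exact .nat (hδ _ hq hxz.1 hxz.2 .nature ▸ hq') (ih (hU.nat_closed _ _ _ _ _ hq hq'))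
      | @p2 s B γ₁ κ g hg _ ih =>
        by_cases hxz : .p2 s B γ₁ κ ∉ ASW₁ D.G2 ∧ .p2 s B γ₁ κ ∉ ASW₁ D.Gplus
        swap
        · exact hother _ hxz
        rw [← hE _ _ _ _ hq hxz.1] at hg ih
        refine .p2 g (fun γ₂ hγ => hδ _ hq hxz.1 hxz.2 (.two γ₂) ▸ hg γ₂ hγ) fun γ₂ hγ =>
          ih γ₂ hγ (hU.p2_closed _ _ _ _ hq γ₂ ?_ (hg γ₂ hγ))
        rwa [← hE _ _ _ _ hq hxz.1]
    · exact (hX.attr q hq).mono hXW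
    · exact (hZ.attr q hq).mono hZW

theorem ASW₁_Gplus_subset_DASW₁ : ASW₁ D.Gplus ⊆ D.DASW₁ :=
  isWinSet_H_ASW₁_Gplus.subset_winRegion isLocalAdversary_H finite_Q

theorem DASW₁_subset : D.DASW₁ ⊆ ASW₁ D.G0 ∪ ASW₁ D.Gplus := by
  have counter : ∀ κ : ℤ, -1 ≤ κ → κ = -1 ∨ 0 ≤ κ := fun κ h => by omega
  intro q hq
  rcases isWinSet_DASW₁.subset hq with ⟨hκ, -⟩ | h
  · cases q with
    | fin => exact hκ.elim
    | _ =>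
      rcases counter _ hκ.1 with h | h
      · exact Or.inl (mem_ASW₁_G0_of_mem_DASW₁ hq h)
      · exact Or.inr (mem_ASW₁_Gplus_of_mem_DASW₁ hq (Or.inl h))
  · exact Or.inr (mem_ASW₁_Gplus_of_mem_DASW₁ hq (Or.inr h))

end Finite

end HiddenSensorGame

end SensorReveal

theorem mainTheorem1 {S A Sen : Type*} [Finite S] [Finite A] [Nonempty A] [Finite Sen]
    (D : SensorReveal.HiddenSensorGame S A Sen) :
    D.DASW₁ = SensorReveal.ASW₁ D.G0 ∪ SensorReveal.ASW₁ D.Gplus :=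
  D.DASW₁_subset.antisymm
    (Set.union_subset D.ASW₁_G0_subset_DASW₁ D.ASW₁_Gplus_subset_DASW₁)
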